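/- Let $n\ge 3$. For measurable $f$ on $\mathbb R^n$ put $\|f\|_{L^{p,\infty}}=\sup_{t>0}t^{1/p}f^*(t)$, where $f^*(t)=\inf\{s>0:|\{x:|f(x)|>s\}|\le t\}$. There is a constant $C_0>0$, depending only on $n$, such that the following holds for all measurable $A:\mathbb R^n\to\mathbb R^n$ and $B:\mathbb R^n\to\mathbb R$ with $$\|A\|_{L^{n,\infty}}\le C_0,\qquad \|B\|_{L^{n/2,\infty}}\le C_0 .$$ (1) The sesquilinear form $$q(u,v)=\big((\nabla+iA)u,(\nabla+iA)v\big)_{L^2}+(Bu,v)_{L^2}$$ is well defined on $H^1(\mathbb R^n)$, that is, $(\nabla+iA)u\in L^2$ and $Bu\bar v\in L^1$ for all $u,v\in H^1$. With its dense domain $H^1(\mathbb R^n)$ in $L^2(\mathbb R^n)$ it is Hermitian, nonnegative and closed: $H^1(\mathbb R^n)$ is complete under the norm $(q(u,u)+\|u\|_{L^2}^2)^{1/2}$. (2) There is a self-adjoint operator $T$ on $L^2(\mathbb R^n)$ which is the operator of the form $q$: for $u,w\in L^2$ one has $u\in D(T)$ and $Tu=w$ if and only if $u\in H^1$ and $q(u,v)=(w,v)_{L^2}$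 for all $v\in H^1$; moreover $D(T)$ is dense in $H^1$ for the norm in (1). (3) $T$ is a self-adjoint realization of $$H=-(\nabla+iA(x))^2+B(x),$$ where $Hu$ is understood as a distribution for $u\in H^1$: for $u,w\in L^2$ one has $u\in D(T)$ and $Tu=w$ if and only if $u\in H^1$ and $Hu=w$ in the sense of distributions. In particular, if $\varphi\in C_0^\infty(\mathbb R^n)$ and the distribution $H\varphi$ is a function $w\in L^2$, then $\varphi\in D(T)$ and $T\varphi=w$. (4) $T$ is unique: if $S$ is a self-adjoint operator on $L^2(\mathbb R^n)$ with $D(S)\subset H^1(\mathbb R^n)$ and $Su=Hu$ in the sense of distributions for all $u\in D(S)$, then $S=T$. -/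

import Mathlib

open MeasureTheory Filter Topology
open scoped ENNReal ContDiff ComplexConjugate

namespace MagneticLaplacian

noncomputable section

/-- Euclidean space `ℝⁿ`. -/
abbrev Rn (n : ℕ) := EuclideanSpace ℝ (Fin n)

/-- The complex Hilbert space `L²(ℝⁿ)`. -/
abbrev L2 (n : ℕ) : Type := Lp ℂ 2 (volume : Measure (Rn n))

/-! ### Weak Lebesgue (Lorentz) quasinorms -/

/-- The non-increasing rearrangement `f*(t) = inf {s > 0 : |{|f| > s}| ≤ t}`, with value `∞` if
there is no such `s`. -/
def rearrangement {n : ℕ} {F : Type*} [NormedAddCommGroup F] (f : Rn n → F) (t : ℝ) : ℝ≥0∞ :=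
  ⨅ (s : ℝ) (_ : 0 < s) (_ : volume {x | s < ‖f x‖} ≤ ENNReal.ofReal t), ENNReal.ofReal s

/-- The quasinorm `sup_{t > 0} t^{1/p} f*(t)` of `L^{p,∞}(ℝⁿ)`. -/
def weakLpNorm {n : ℕ} {F : Type*} [NormedAddCommGroup F] (p : ℝ) (f : Rn n → F) : ℝ≥0∞ :=
  ⨆ (t : ℝ) (_ : 0 < t), ENNReal.ofReal (t ^ (1 / p)) * rearrangement f t

/-! ### The Sobolev space `H¹(ℝⁿ)` -/

/-- Complex-valued test functions, the elements of `C₀^∞(ℝⁿ)`. -/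
structure IsTest {n : ℕ} (φ : Rn n → ℂ) : Prop where
  smooth : ContDiff ℝ ∞ φ
  compact : HasCompactSupport φ

/-- The classical partial derivative `∂ⱼ φ`. -/
def pderiv {n : ℕ} (j : Fin n) (φ : Rn n → ℂ) (x : Rn n) : ℂ :=
  fderiv ℝ φ x (EuclideanSpace.single j 1)

/-- `g` is the weak partial derivative `∂ⱼ u`. -/
def HasWeakPartial {n : ℕ} (j : Fin n) (u g : L2 n) : Prop :=
  ∀ φ : Rn n → ℂ, IsTest φ → ∫ x, u x * pderiv j φ x = -∫ x, g x * φ x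

lemma IsTest.memLp {n : ℕ} {φ : Rn n → ℂ} (h : IsTest φ) : MemLp φ 2 volume :=
  h.smooth.continuous.memLp_of_hasCompactSupport h.compact

lemma IsTest.memLp_pderiv {n : ℕ} {φ : Rn n → ℂ} (h : IsTest φ) (j : Fin n) :
    MemLp (pderiv j φ) 2 volume := by
  have hc : Continuous (pderiv j φ) :=
    (h.smooth.continuous_fderiv (by simp)).clm_apply continuous_const
  refine hc.memLp_of_hasCompactSupport ?_
  exact (h.compact.fderiv (𝕜 := ℝ)).comp_left
    (g := fun L : Rn n →L[ℝ] ℂ => L (EuclideanSpace.single j 1)) (by simp)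

lemma integrable_L2_mul {n : ℕ} (u : L2 n) {f : Rn n → ℂ} (hf : MemLp f 2 volume) :
    Integrable (fun x => u x * f x) volume :=
  (Lp.memLp u).integrable_mul hf

lemma HasWeakPartial.zero {n : ℕ} (j : Fin n) : HasWeakPartial j (0 : L2 n) 0 := by
  intro φ _
  have h0 : ∀ f : Rn n → ℂ, ∫ x, (0 : L2 n) x * f x = 0 := by
    intro f
    refine integral_eq_zero_of_ae ?_
    filter_upwards [Lp.coeFn_zero ℂ 2 (volume : Measure (Rn n))] with x hx
    simp only [hx, Pi.zero_apply, zero_mul]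
  rw [h0, h0, neg_zero]

lemma integral_add_mul {n : ℕ} (u v : L2 n) {f : Rn n → ℂ} (hf : MemLp f 2 volume) :
    ∫ x, (u + v : L2 n) x * f x = (∫ x, u x * f x) + ∫ x, v x * f x := by
  rw [← integral_add (integrable_L2_mul u hf) (integrable_L2_mul v hf)]
  refine integral_congr_ae ?_
  filter_upwards [Lp.coeFn_add u v] with x hx
  simp only [hx, Pi.add_apply, add_mul]

lemma integral_smul_mul {n : ℕ} (c : ℂ) (u : L2 n) (f : Rn n → ℂ) :
    ∫ x, (c • u : L2 n) x * f x = c * ∫ x, u x * f x := by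
  rw [← integral_const_mul]
  refine integral_congr_ae ?_
  filter_upwards [Lp.coeFn_smul c u] with x hx
  simp only [hx, Pi.smul_apply, smul_eq_mul, mul_assoc]

lemma HasWeakPartial.add {n : ℕ} {j : Fin n} {u v g h : L2 n} (hu : HasWeakPartial j u g)
    (hv : HasWeakPartial j v h) : HasWeakPartial j (u + v) (g + h) := by
  intro φ hφ
  rw [integral_add_mul u v (hφ.memLp_pderiv j), integral_add_mul g h hφ.memLp, hu φ hφ, hv φ hφ]
  ring

lemma HasWeakPartial.smul {n : ℕ} {j : Fin n} {u g : L2 n} (c : ℂ) (hu : HasWeakPartial j u g) :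
    HasWeakPartial j (c • u) (c • g) := by
  intro φ hφ
  rw [integral_smul_mul, integral_smul_mul, hu φ hφ]
  ring

/-- The Sobolev space `H¹(ℝⁿ)`: the `u ∈ L²` all of whose weak first partial derivatives are
in `L²`. -/
def H1 (n : ℕ) : Submodule ℂ (L2 n) where
  carrier := {u | ∀ j, ∃ g : L2 n, HasWeakPartial j u g}
  zero_mem' j := ⟨0, HasWeakPartial.zero j⟩
  add_mem' hu hv j := by
    obtain ⟨g, hg⟩ := hu j
    obtain ⟨h, hh⟩ := hv j
    exact ⟨g + h, hg.add hh⟩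
  smul_mem' c u hu j := by
    obtain ⟨g, hg⟩ := hu j
    exact ⟨c • g, hg.smul c⟩

/-- The weak partial derivative `∂ⱼ u ∈ L²` of `u ∈ H¹`. -/
def weakPartial {n : ℕ} (u : H1 n) (j : Fin n) : L2 n := Classical.choose (u.2 j)

lemma weakPartial_spec {n : ℕ} (u : H1 n) (j : Fin n) :
    HasWeakPartial j (u : L2 n) (weakPartial u j) := Classical.choose_spec (u.2 j)

/-- Weak partial derivatives are unique, so `weakPartial` does not depend on the choice made. -/
lemma HasWeakPartial.unique {n : ℕ} {j : Fin n} {u g h : L2 n} (hg : HasWeakPartial j u g)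
    (hh : HasWeakPartial j u h) : g = h := by
  refine Lp.ext ?_
  refine ae_eq_of_integral_contDiff_smul_eq
    ((Lp.memLp g).locallyIntegrable (by norm_num)) ((Lp.memLp h).locallyIntegrable (by norm_num))
    fun ψ hψ hc => ?_
  have ht : IsTest (fun x => (ψ x : ℂ)) :=
    ⟨Complex.ofRealCLM.contDiff.comp hψ, hc.comp_left (g := fun r : ℝ => (r : ℂ)) (by simp)⟩
  have e := neg_injective ((hg _ ht).symm.trans (hh _ ht))
  simpa [Complex.real_smul, mul_comm] using e

/-! ### The magnetic Laplacian `H = -(∇ + iA)² + B` -/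

/-- The covariant derivative `(∂ⱼ + i Aⱼ) u` of a function `u` with gradient `g`. -/
def covDeriv {n : ℕ} (A : Rn n → Rn n) (u : Rn n → ℂ) (g : Fin n → Rn n → ℂ) (j : Fin n)
    (x : Rn n) : ℂ :=
  g j x + Complex.I * (A x j : ℂ) * u x

/-- The pairing with a test function `η` of the distribution
`H u = -∑ⱼ (∂ⱼ + i Aⱼ) (∂ⱼ + i Aⱼ) u + B u`, where `u` is a function with gradient `g`; the outer
derivative is moved to `η`. -/
def distribH {n : ℕ} (A : Rn n → Rn n) (B : Rn n → ℝ) (u : Rn n → ℂ) (g : Fin n → Rn n → ℂ)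
    (η : Rn n → ℂ) : ℂ :=
  (∑ j, ∫ x, covDeriv A u g j x * (pderiv j η x - Complex.I * (A x j : ℂ) * η x)) +
    ∫ x, (B x : ℂ) * u x * η x

/-- For `u ∈ H¹` and `w ∈ L²`: `H u = w` in the sense of distributions. -/
def WeaklyEq {n : ℕ} (A : Rn n → Rn n) (B : Rn n → ℝ) (u : H1 n) (w : L2 n) : Prop :=
  ∀ η : Rn n → ℂ, IsTest η →
    ∫ x, w x * η x = distribH A B (u : L2 n) (fun j => weakPartial u j) η

/-- For `φ ∈ C₀^∞` and `w ∈ L²`: `H φ = w` in the sense of distributions. -/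
def WeaklyEqTest {n : ℕ} (A : Rn n → Rn n) (B : Rn n → ℝ) (φ : Rn n → ℂ) (w : L2 n) : Prop :=
  ∀ η : Rn n → ℂ, IsTest η → ∫ x, w x * η x = distribH A B φ (fun j => pderiv j φ) η

/-- The covariant derivative `(∂ⱼ + i Aⱼ) u` of `u ∈ H¹`. -/
def covDerivH1 {n : ℕ} (A : Rn n → Rn n) (u : H1 n) (j : Fin n) (x : Rn n) : ℂ :=
  covDeriv A (u : L2 n) (fun j => weakPartial u j) j x

/-- The form `q(u, v) = ((∇ + iA) u, (∇ + iA) v)_{L²} + (B u, v)_{L²}` on `H¹`, linear in `u` and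
conjugate-linear in `v`. -/
def magForm {n : ℕ} (A : Rn n → Rn n) (B : Rn n → ℝ) (u v : H1 n) : ℂ :=
  (∑ j, ∫ x, covDerivH1 A u j x * conj (covDerivH1 A v j x)) +
    ∫ x, (B x : ℂ) * (u : L2 n) x * conj ((v : L2 n) x)

/-- All the integrals in the form `magForm A B` converge absolutely. -/
structure FormWellDefined {n : ℕ} (A : Rn n → Rn n) (B : Rn n → ℝ) : Prop where
  covDeriv_memLp : ∀ (u : H1 n) (j : Fin n), MemLp (covDerivH1 A u j) 2 volume
  potential_integrable : ∀ u v : H1 n,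
    Integrable (fun x => (B x : ℂ) * (u : L2 n) x * conj ((v : L2 n) x)) volume

/-! ### Quadratic forms and their operators in a Hilbert space -/

section Forms

variable {K : Type*} [NormedAddCommGroup K] [InnerProductSpace ℂ K]

/-- The squared form norm `q(u, u) + ‖u‖²`. -/
def formNormSq {D : Submodule ℂ K} (q : D → D → ℂ) (u : D) : ℝ := (q u u).re + ‖(u : K)‖ ^ 2

/-- `q` is a densely defined, closed, nonnegative, Hermitian sesquilinear form with domain `D`;
closed means that `D` is complete under the form norm. -/
structure IsClosedNonnegForm (D : Submodule ℂ K) (q : D → D → ℂ) : Prop where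
  dense : Dense (D : Set K)
  add_left : ∀ u v w, q (u + v) w = q u w + q v w
  smul_left : ∀ (c : ℂ) u v, q (c • u) v = c * q u v
  hermitian : ∀ u v, q v u = conj (q u v)
  nonneg : ∀ u, 0 ≤ (q u u).re
  complete : ∀ u : ℕ → D,
    (∀ ε > 0, ∃ N, ∀ k ≥ N, ∀ m ≥ N, formNormSq q (u k - u m) < ε) →
      ∃ v : D, Tendsto (fun k => formNormSq q (u k - v)) atTop (𝓝 0)

/-- `T` is the operator associated with the form `q`: its domain consists of the `u ∈ D` for which
`v ↦ q(u, v)` is `v ↦ (w, v)` for some `w` in the Hilbert space, then `T u = w`; and its domain is a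
core of `q`, so that the form domain of `T` is all of `D`. -/
structure IsFormOperator {D : Submodule ℂ K} (q : D → D → ℂ) (T : K →ₗ.[ℂ] K) : Prop where
  mem_graph_iff : ∀ u w : K,
    (u, w) ∈ T.graph ↔ ∃ hu : u ∈ D, ∀ v : D, q ⟨u, hu⟩ v = inner ℂ (v : K) w
  core : ∀ u : D, ∀ ε > 0, ∃ v : D, (v : K) ∈ T.domain ∧ formNormSq q (u - v) < ε

end Forms

end

end MagneticLaplacian

/-! Everything rests on one Hardy-type inequality: if a weight satisfies `∫_E w ≤ K |E|^(1 - 2/n)`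
for all sets `E`, then `∫ w |u|² ≤ C K ∫ |∇u|²`. By the layer-cake formula, `|A|²` and `|B|` are
such weights with `K` equal to `3 C₀²` and `3 C₀`. The inequality itself
(`exists_lintegral_mul_enorm_sq_le`) comes from the Sobolev inequality by truncation: cut `|φ|`
between the levels `a` and `2a`, apply Sobolev to the cutoff, and sum over dyadic `a`. The gradients
of the cutoffs live on disjoint shells, so no constant is lost in the sum. Density of test functions
and Fatou's lemma extend the bound to `H¹`.

For small `C₀` both potential terms are at most `1/8` of the Dirichlet integral, which puts `q(u,
u)` between `1/4` and `3` times `∫ |∇u|²`. The form norm is then equivalent to the `H¹` norm, and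
`q` is nonnegative and closed because `H¹` is complete.

The operator comes from the representation theorem for closed forms. With `ι` the inclusion of the
form domain in `L²`, `ι ι*` is the resolvent `(T + 1)⁻¹`; `T` is symmetric and `T + 1` is onto,
hence `T` is self-adjoint. Pairing `Hu` with a test function `η` is the same as evaluating `q(u,
conj η)`, and test functions are dense in the form norm, so the form and distributional descriptions
of `T` agree (`FormSmall.weaklyEq_iff`). That description is maximal within `H¹`, so any competitor
`S` is a restriction of `T`, and a self-adjoint operator has no proper self-adjoint extension. -/

namespace MagneticLaplacian

/-! ### Weak Lebesgue spaces -/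

lemma volume_lt_norm_le_of_weakLpNorm {n : ℕ} {F : Type*} [NormedAddCommGroup F] {f : Rn n → F}
    {p C : ℝ} (hp : 0 < p) (hC : 0 < C) (h : weakLpNorm p f ≤ ENNReal.ofReal C) {s : ℝ}
    (hs : 0 < s) : volume {x | s < ‖f x‖} ≤ ENNReal.ofReal ((C / s) ^ p) := by
  by_contra! hlt
  -- A time `t` strictly between the claimed bound and the measure. Strictness on the left forces
  -- `f*(t) < s`, so the infimum has a witness below `s`; that witness contradicts the right-hand
  -- inequality.
  obtain ⟨t, -, ht1, ht2⟩ := ENNReal.lt_iff_exists_real_btwn.1 hlt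
  have hpos : 0 < (C / s) ^ p := Real.rpow_pos_of_pos (div_pos hC hs) p
  have ht : (C / s) ^ p < t := (ENNReal.ofReal_lt_ofReal_iff_of_nonneg hpos.le).1 ht1
  have ht0 : 0 < t := hpos.trans ht
  have hroot : C / s < t ^ (1 / p) := by
    have := Real.rpow_lt_rpow hpos.le ht (one_div_pos.2 hp)
    rwa [← Real.rpow_mul (div_pos hC hs).le, mul_one_div_cancel hp.ne', Real.rpow_one] at this
  have hle : ENNReal.ofReal (t ^ (1 / p)) * rearrangement f t ≤ ENNReal.ofReal C :=
    (le_iSup₂ (f := fun (t : ℝ) (_ : 0 < t) =>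
      ENNReal.ofReal (t ^ (1 / p)) * rearrangement f t) t ht0).trans h
  have hre : rearrangement f t < ENNReal.ofReal s := by
    by_contra! hge
    have h1 : ENNReal.ofReal (t ^ (1 / p) * s) ≤ ENNReal.ofReal C := by
      rw [ENNReal.ofReal_mul (Real.rpow_nonneg ht0.le _)]
      exact (mul_le_mul_right hge _).trans hle
    have h2 := (ENNReal.ofReal_le_ofReal_iff hC.le).1 h1
    rw [div_lt_iff₀ hs] at hroot
    linarith
  simp only [rearrangement, iInf_lt_iff] at hre
  obtain ⟨s', hs', hvol, hlt'⟩ := hre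
  have hss : s' < s := (ENNReal.ofReal_lt_ofReal_iff hs).1 hlt'
  have : volume {x | s < ‖f x‖} ≤ ENNReal.ofReal t :=
    (measure_mono fun x (hx : s < ‖f x‖) => hss.trans hx).trans hvol
  exact absurd ht2 this.not_gt

/-- Layer cake: below a threshold level the measure of `E` bounds the superlevel sets, above it the
distribution bound does, integrable at infinity because `r > 1`. The two pieces contribute `1` and
`1 / (r - 1)`, which add up to `r / (r - 1)`. -/
lemma setLIntegral_ofReal_le_of_distribution {α : Type*} [MeasurableSpace α] {μ : Measure α}
    {w : α → ℝ} (hw0 : ∀ x, 0 ≤ w x) (hw : AEMeasurable w μ) {K r : ℝ} (hK : 0 < K) (hr : 1 < r)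
    (h : ∀ s : ℝ, 0 < s → μ {x | s < w x} ≤ ENNReal.ofReal ((K / s) ^ r)) (E : Set α) :
    ∫⁻ x in E, ENNReal.ofReal (w x) ∂μ ≤
      ENNReal.ofReal (r / (r - 1) * K) * μ E ^ (1 - 1 / r) := by
  have hr0 : 0 < r := by linarith
  have hr1 : 0 < r - 1 := by linarith
  have hexp : 0 < 1 - 1 / r := by
    rw [sub_pos, div_lt_one hr0]; exact hr
  have hc : 0 < r / (r - 1) * K := by positivity
  rcases eq_or_ne (μ E) 0 with h0 | h0
  · rw [Measure.restrict_eq_zero.2 h0]; simp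
  rcases eq_or_ne (μ E) ∞ with ht | ht
  · rw [ht, ENNReal.top_rpow_of_pos hexp, ENNReal.mul_top (by simpa using hc)]
    exact le_top
  set m := (μ E).toReal with hm
  have hm0 : 0 < m := ENNReal.toReal_pos h0 ht
  have hmE : μ E = ENNReal.ofReal m := (ENNReal.ofReal_toReal ht).symm
  -- The level at which the two bounds agree: `(K / a) ^ r = m`.
  set a := K * m ^ (-1 / r) with ha
  have ha0 : 0 < a := by positivity
  have hpow : Set.EqOn (fun s : ℝ => (K / s) ^ r) (fun s => K ^ r * s ^ (-r)) (Set.Ioi a) := by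
    intro s (hs : a < s)
    have hs0 : 0 < s := ha0.trans hs
    simp only
    rw [Real.div_rpow hK.le hs0.le, Real.rpow_neg hs0.le, div_eq_mul_inv]
  have hint : IntegrableOn (fun s : ℝ => (K / s) ^ r) (Set.Ioi a) volume :=
    (integrableOn_congr_fun hpow measurableSet_Ioi).2
      ((integrableOn_Ioi_rpow_of_lt (a := -r) (by linarith) ha0).const_mul (K ^ r))
  have hval : ∫ s in Set.Ioi a, (K / s) ^ r = K * m ^ (1 - 1 / r) / (r - 1) := by
    have : ∫ s in Set.Ioi a, (K / s) ^ r = ∫ s in Set.Ioi a, K ^ r * s ^ (-r) :=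
      setIntegral_congr_fun measurableSet_Ioi hpow
    rw [this, integral_const_mul, integral_Ioi_rpow_of_lt (by linarith) ha0, ha,
      Real.mul_rpow hK.le (by positivity), ← Real.rpow_mul hm0.le]
    have e1 : -1 / r * (-r + 1) = 1 - 1 / r := by field_simp; ring
    have e2 : K ^ r * K ^ (-r + 1) = K := by
      rw [← Real.rpow_add hK]; simp
    rw [e1]
    have e3 : -r + 1 = -(r - 1) := by ring
    calc K ^ r * (-(K ^ (-r + 1) * m ^ (1 - 1 / r)) / (-r + 1))
        = (K ^ r * K ^ (-r + 1)) * m ^ (1 - 1 / r) / (r - 1) := by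
          rw [e3, neg_div_neg_eq]; ring
      _ = _ := by rw [e2]
  have hlayer := lintegral_eq_lintegral_meas_lt (μ.restrict E)
    (Eventually.of_forall hw0) hw.restrict
  rw [hlayer, ← Set.Ioc_union_Ioi_eq_Ioi ha0.le]
  refine (lintegral_union_le _ _ _).trans ?_
  have b1 : ∫⁻ s in Set.Ioc 0 a, (μ.restrict E) {x | s < w x} ≤
      ENNReal.ofReal (K * m ^ (1 - 1 / r)) := by
    calc ∫⁻ s in Set.Ioc 0 a, (μ.restrict E) {x | s < w x}
        ≤ ∫⁻ s in Set.Ioc 0 a, μ E :=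
          lintegral_mono fun s => (measure_mono (Set.subset_univ _)).trans (by simp)
      _ = ENNReal.ofReal (K * m ^ (1 - 1 / r)) := by
          rw [setLIntegral_const, Real.volume_Ioc, sub_zero, hmE,
            ← ENNReal.ofReal_mul hm0.le, ha]
          congr 1
          rw [show 1 - 1 / r = 1 + -1 / r by ring, Real.rpow_add hm0, Real.rpow_one]
          ring
  have b2 : ∫⁻ s in Set.Ioi a, (μ.restrict E) {x | s < w x} ≤
      ENNReal.ofReal (K * m ^ (1 - 1 / r) / (r - 1)) := by
    calc ∫⁻ s in Set.Ioi a, (μ.restrict E) {x | s < w x}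
        ≤ ∫⁻ s in Set.Ioi a, ENNReal.ofReal ((K / s) ^ r) := by
          refine setLIntegral_mono_ae' measurableSet_Ioi (Eventually.of_forall fun s hs => ?_)
          exact (Measure.restrict_apply_le _ _).trans (h s (ha0.trans hs))
      _ = ENNReal.ofReal (K * m ^ (1 - 1 / r) / (r - 1)) := by
          rw [← hval, ofReal_integral_eq_lintegral_ofReal hint]
          refine (ae_restrict_iff' measurableSet_Ioi).2 (Eventually.of_forall fun s hs => ?_)
          have : 0 < s := ha0.trans hs
          positivity
  refine (add_le_add b1 b2).trans_eq ?_
  rw [hmE, ENNReal.ofReal_rpow_of_pos hm0, ← ENNReal.ofReal_add (by positivity) (by positivity),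
    ← ENNReal.ofReal_mul hc.le]
  congr 1
  field_simp
  ring

/-- The case `r = n / 2`. The factor `r / (r - 1) = n / (n - 2)` is at most `3` exactly because `n ≥
3`. -/
lemma setLIntegral_enorm_le_of_weakLpNorm {n : ℕ} (hn : 3 ≤ n) {B : Rn n → ℝ}
    (hB : AEMeasurable B volume) {C : ℝ} (hC : 0 < C)
    (h : weakLpNorm ((n : ℝ) / 2) B ≤ ENNReal.ofReal C) (E : Set (Rn n)) :
    ∫⁻ x in E, ‖B x‖ₑ ≤ ENNReal.ofReal (3 * C) * volume E ^ (1 - 2 / (n : ℝ)) := by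
  have hn' : (3 : ℝ) ≤ n := by exact_mod_cast hn
  have key := setLIntegral_ofReal_le_of_distribution (μ := volume) (w := fun x => ‖B x‖)
    (fun x => norm_nonneg _) hB.norm hC (r := (n : ℝ) / 2) (by linarith)
    (fun s hs => volume_lt_norm_le_of_weakLpNorm (by linarith) hC h hs) E
  simp only [ofReal_norm] at key
  refine key.trans ?_
  rw [one_div_div]
  gcongr
  rw [div_le_iff₀ (by linarith)]
  linarith

/-- Squaring turns a weak `L^n` bound with constant `C` into a weak `L^(n/2)` bound with constant
`C²`. -/
lemma setLIntegral_enorm_sq_le_of_weakLpNorm {n : ℕ} (hn : 3 ≤ n) {A : Rn n → Rn n}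
    (hA : AEMeasurable A volume) {C : ℝ} (hC : 0 < C)
    (h : weakLpNorm (n : ℝ) A ≤ ENNReal.ofReal C) (E : Set (Rn n)) :
    ∫⁻ x in E, ‖A x‖ₑ ^ 2 ≤ ENNReal.ofReal (3 * C ^ 2) * volume E ^ (1 - 2 / (n : ℝ)) := by
  have hn' : (3 : ℝ) ≤ n := by exact_mod_cast hn
  have key := setLIntegral_ofReal_le_of_distribution (μ := volume) (w := fun x => ‖A x‖ ^ 2)
    (fun x => by positivity) (hA.norm.pow_const 2) (K := C ^ 2) (by positivity)
    (r := (n : ℝ) / 2) (by linarith) (fun s hs => ?_) E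
  · have e : ∀ x, ENNReal.ofReal (‖A x‖ ^ 2) = ‖A x‖ₑ ^ 2 := fun x => by
      rw [ENNReal.ofReal_pow (norm_nonneg _), ofReal_norm]
    simp only [e] at key
    refine key.trans ?_
    rw [one_div_div]
    gcongr
    rw [div_le_iff₀ (by linarith)]
    linarith
  · have hsub : {x | s < ‖A x‖ ^ 2} ⊆ {x | √s < ‖A x‖} := fun x (hx : s < ‖A x‖ ^ 2) =>
      (Real.sqrt_lt_sqrt hs.le hx).trans_eq (Real.sqrt_sq (norm_nonneg _))
    have hs' : 0 < √s := Real.sqrt_pos.2 hs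
    refine (measure_mono hsub).trans
      ((volume_lt_norm_le_of_weakLpNorm (by linarith) hC h hs').trans_eq ?_)
    congr 1
    have e : C ^ 2 / s = (C / √s) ^ (2 : ℝ) := by
      rw [Real.rpow_two, div_pow, Real.sq_sqrt hs.le]
    rw [e, ← Real.rpow_mul (by positivity), mul_div_cancel₀ _ two_ne_zero]

/-! ### Smooth truncation -/

/-- Every such point, endpoints included, is a global minimum or maximum. Including the endpoints
makes the shells carrying the cutoff gradients open, hence disjoint. -/
lemma deriv_smoothTransition_of_notMem {y : ℝ} (hy : y ∉ Set.Ioo (0 : ℝ) 1) :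
    deriv Real.smoothTransition y = 0 := by
  rw [Set.mem_Ioo, not_and_or, not_lt, not_lt] at hy
  rcases hy with hy | hy
  · refine IsLocalMin.deriv_eq_zero (Eventually.of_forall fun z => ?_)
    simpa [Real.smoothTransition.zero_of_nonpos hy] using Real.smoothTransition.nonneg z
  · refine IsLocalMax.deriv_eq_zero (Eventually.of_forall fun z => ?_)
    simpa [Real.smoothTransition.one_of_one_le hy] using Real.smoothTransition.le_one z

lemma exists_abs_deriv_smoothTransition_le :
    ∃ M : ℝ, 0 < M ∧ ∀ y, |deriv Real.smoothTransition y| ≤ M := by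
  have hc : Continuous (deriv Real.smoothTransition) :=
    (Real.smoothTransition.contDiff (n := 1)).continuous_deriv le_rfl
  obtain ⟨M, hM⟩ := isCompact_Icc.exists_bound_of_continuousOn
    (hc.continuousOn (s := Set.Icc (0 : ℝ) 1))
  refine ⟨max M 1, by positivity, fun y => ?_⟩
  by_cases hy : y ∈ Set.Ioo (0 : ℝ) 1
  · exact (hM y (Set.Ioo_subset_Icc_self hy)).trans (le_max_left _ _)
  · rw [deriv_smoothTransition_of_notMem hy]; simp

/-- A smooth cutoff of `‖φ‖` between the levels `a` and `2 * a`. -/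
noncomputable def levelCutoff {E : Type*} (φ : E → ℂ) (a : ℝ) (x : E) : ℝ :=
  Real.smoothTransition ((‖φ x‖ ^ 2 / a ^ 2 - 1) / 3)

section LevelCutoff

variable {E : Type*} {φ : E → ℂ} {a : ℝ}

lemma levelCutoff_eq_one (ha : 0 < a) {x : E} (hx : 2 * a ≤ ‖φ x‖) : levelCutoff φ a x = 1 := by
  refine Real.smoothTransition.one_of_one_le ?_
  have : 4 ≤ ‖φ x‖ ^ 2 / a ^ 2 := by
    rw [le_div_iff₀ (by positivity)]; nlinarith
  linarith

lemma levelCutoff_eq_zero (ha : 0 < a) {x : E} (hx : ‖φ x‖ ≤ a) : levelCutoff φ a x = 0 := by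
  refine Real.smoothTransition.zero_of_nonpos ?_
  have : ‖φ x‖ ^ 2 / a ^ 2 ≤ 1 := by
    rw [div_le_one (by positivity)]; gcongr
  linarith

variable [NormedAddCommGroup E]

lemma hasCompactSupport_levelCutoff (ha : 0 < a) (hφ : HasCompactSupport φ) :
    HasCompactSupport (levelCutoff φ a) := by
  refine hφ.mono fun x hx => ?_
  contrapose! hx
  have : φ x = 0 := by simpa using hx
  simpa using levelCutoff_eq_zero ha (x := x) (by simp [this, ha.le])

variable [NormedSpace ℝ E]

/-- The cutoff is a function of `‖φ‖²` and not of `‖φ‖`, so zeros of `φ` cause no loss of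
smoothness. -/
lemma contDiff_levelCutoff (hφ : ContDiff ℝ 1 φ) : ContDiff ℝ 1 (levelCutoff φ a) :=
  Real.smoothTransition.contDiff.comp ((((hφ.norm_sq ℝ).div_const _).sub
      contDiff_const).div_const _)

/-- On the shell `‖φ‖ < 2a`, so the chain rule gives at most `M * 2 * (2a) / (3a²) = 4M / (3a)`
times the gradient of `φ`. Off the shell the transition function is flat. -/
lemma enorm_fderiv_levelCutoff_le (ha : 0 < a) {M : ℝ} (hM0 : 0 < M)
    (hM : ∀ y, |deriv Real.smoothTransition y| ≤ M) (hφ : ContDiff ℝ 1 φ) (x : E) :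
    ‖fderiv ℝ (levelCutoff φ a) x‖ₑ ≤ {x | a < ‖φ x‖ ∧ ‖φ x‖ < 2 * a}.indicator
      (fun x => ENNReal.ofReal (2 * M / a) * ‖fderiv ℝ φ x‖ₑ) x := by
  have hφx : HasFDerivAt φ (fderiv ℝ φ x) x := (hφ.differentiable one_ne_zero x).hasFDerivAt
  have hinner : HasFDerivAt (fun x => (‖φ x‖ ^ 2 / a ^ 2 - 1) / 3)
      ((3⁻¹ * (a ^ 2)⁻¹ : ℝ) • (2 • (innerSL ℝ (φ x)).comp (fderiv ℝ φ x))) x := by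
    have := ((hφx.norm_sq.mul_const (a ^ 2)⁻¹).sub_const 1).mul_const (3⁻¹ : ℝ)
    simp only [div_eq_mul_inv]
    convert! this using 1
    rw [smul_smul]
  have hS : HasDerivAt Real.smoothTransition
      (deriv Real.smoothTransition ((‖φ x‖ ^ 2 / a ^ 2 - 1) / 3)) ((‖φ x‖ ^ 2 / a ^ 2 - 1) / 3) :=
    ((Real.smoothTransition.contDiff (n := 1)).differentiable one_ne_zero _).hasDerivAt
  have hcomp := (hS.comp_hasFDerivAt x hinner).fderiv
  change fderiv ℝ (levelCutoff φ a) x = _ at hcomp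
  rw [hcomp]
  by_cases hx : a < ‖φ x‖ ∧ ‖φ x‖ < 2 * a
  · rw [Set.indicator_of_mem (by exact hx), ← ofReal_norm, ← ofReal_norm, ← ENNReal.ofReal_mul
      (by positivity)]
    refine ENNReal.ofReal_le_ofReal ?_
    have h1 : ‖(innerSL ℝ (φ x)).comp (fderiv ℝ φ x)‖ ≤ ‖φ x‖ * ‖fderiv ℝ φ x‖ :=
      (ContinuousLinearMap.opNorm_comp_le _ _).trans_eq (by rw [innerSL_apply_norm])
    have h2 : ‖(2 : ℕ) • (innerSL ℝ (φ x)).comp (fderiv ℝ φ x)‖ ≤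
        2 * (2 * a * ‖fderiv ℝ φ x‖) := by
      refine (norm_nsmul_le).trans ?_
      push_cast
      have := mul_le_mul_of_nonneg_right hx.2.le (norm_nonneg (fderiv ℝ φ x))
      linarith
    rw [norm_smul, norm_smul, Real.norm_eq_abs, Real.norm_of_nonneg (by positivity)]
    calc _ ≤ M * (3⁻¹ * (a ^ 2)⁻¹ * (2 * (2 * a * ‖fderiv ℝ φ x‖))) := by
          gcongr
          exact hM _
      _ = 4 / 3 * (M / a * ‖fderiv ℝ φ x‖) := by field_simp; ring
      _ ≤ 2 * (M / a * ‖fderiv ℝ φ x‖) := by gcongr; norm_num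
      _ = 2 * M / a * ‖fderiv ℝ φ x‖ := by ring
  · rw [deriv_smoothTransition_of_notMem, zero_smul]
    · exact (enorm_zero (E := E →L[ℝ] ℝ)).trans_le bot_le
    · refine fun hy => hx ⟨?_, ?_⟩
      · by_contra! hle
        have : ‖φ x‖ ^ 2 / a ^ 2 ≤ 1 := by
          rw [div_le_one (by positivity)]; gcongr
        linarith [hy.1]
      · by_contra! hle
        have : 4 ≤ ‖φ x‖ ^ 2 / a ^ 2 := by
          rw [le_div_iff₀ (by positivity)]; nlinarith
        linarith [hy.2]

end LevelCutoff

/-! ### The Hardy inequality for weights in weak Lebesgue spaces -/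

/-- The cutoff equals `1` on the superlevel set, so Chebyshev bounds the measure by its Sobolev
norm; its gradient sees only the shell and brings the factor `1 / a`. -/
lemma exists_volume_level_rpow_le {n : ℕ} (hn : 3 ≤ n) :
    ∃ C : ℝ, 0 < C ∧ ∀ (φ : Rn n → ℂ), ContDiff ℝ 1 φ → HasCompactSupport φ → ∀ a : ℝ, 0 < a →
      volume {x | 2 * a ≤ ‖φ x‖} ^ (1 - 2 / (n : ℝ)) ≤ ENNReal.ofReal (C / a ^ 2) *
        ∫⁻ x in {x | a < ‖φ x‖ ∧ ‖φ x‖ < 2 * a}, ‖fderiv ℝ φ x‖ₑ ^ 2 := by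
  obtain ⟨M, hM0, hM⟩ := exists_abs_deriv_smoothTransition_le
  have hn' : (3 : ℝ) ≤ n := by exact_mod_cast hn
  set S : NNReal := SNormLESNormFDerivOfEqConst ℝ (volume : Measure (Rn n)) 2
  -- `S + 1` replaces the Sobolev constant `S` to make positivity automatic.
  refine ⟨((S : ℝ) + 1) ^ 2 * (2 * M) ^ 2, by positivity, fun φ hφ hc a ha => ?_⟩
  set ψ := levelCutoff φ a
  have hexp : 0 < 1 - 2 / (n : ℝ) := by
    rw [sub_pos, div_lt_one] <;> linarith
  -- The Sobolev exponent `2n / (n - 2)`.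
  obtain ⟨q, hq⟩ : ∃ q : NNReal, (q : ℝ) = 2 / (1 - 2 / (n : ℝ)) :=
    ⟨⟨_, by positivity⟩, rfl⟩
  have hq0 : 0 < (q : ℝ) := by rw [hq]; positivity
  have hsob := eLpNorm_le_eLpNorm_fderiv_of_eq (volume : Measure (Rn n)) (u := ψ)
    (contDiff_levelCutoff hφ) (hasCompactSupport_levelCutoff ha hc) (p := 2) (p' := q)
    (by norm_num) (by simp; omega) (by
      rw [hq, inv_div, finrank_euclideanSpace_fin]; push_cast; field_simp)
  have hcheb := mul_meas_ge_le_pow_eLpNorm' volume (p := (q : ℝ≥0∞))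
    (by exact_mod_cast hq0.ne') (by simp)
    (contDiff_levelCutoff (a := a) hφ).continuous.aestronglyMeasurable 1
  rw [ENNReal.one_rpow, one_mul, ENNReal.coe_toReal] at hcheb
  have hlev : volume {x | 2 * a ≤ ‖φ x‖} ≤ eLpNorm ψ q volume ^ (q : ℝ) := by
    refine (measure_mono fun x (hx : 2 * a ≤ ‖φ x‖) => ?_).trans hcheb
    simp [levelCutoff_eq_one ha hx]
  have hmeas : MeasurableSet {x | a < ‖φ x‖ ∧ ‖φ x‖ < 2 * a} :=
    (measurableSet_lt measurable_const hφ.continuous.norm.measurable).inter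
      (measurableSet_lt hφ.continuous.norm.measurable measurable_const)
  have hgrad : eLpNorm (fderiv ℝ ψ) 2 volume ^ 2 ≤ ENNReal.ofReal (2 * M / a) ^ 2 *
      ∫⁻ x in {x | a < ‖φ x‖ ∧ ‖φ x‖ < 2 * a}, ‖fderiv ℝ φ x‖ₑ ^ 2 := by
    rw [eLpNorm_eq_lintegral_rpow_enorm_toReal two_ne_zero ENNReal.ofNat_ne_top,
        ENNReal.toReal_ofNat,
      ← ENNReal.rpow_two, ← ENNReal.rpow_mul, one_div_mul_cancel two_ne_zero, ENNReal.rpow_one,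
      ← lintegral_const_mul' _ _ (by simp), ← lintegral_indicator hmeas]
    refine lintegral_mono fun x => ?_
    refine (ENNReal.rpow_le_rpow (enorm_fderiv_levelCutoff_le ha hM0 hM hφ x) zero_le_two).trans ?_
    by_cases hx : x ∈ {x | a < ‖φ x‖ ∧ ‖φ x‖ < 2 * a}
    · simp only [Set.indicator_of_mem hx]
      rw [ENNReal.rpow_two, mul_pow]
    · simp only [Set.indicator_of_notMem hx]
      simp
  calc volume {x | 2 * a ≤ ‖φ x‖} ^ (1 - 2 / (n : ℝ))
      ≤ (eLpNorm ψ q volume ^ (q : ℝ)) ^ (1 - 2 / (n : ℝ)) := by gcongr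
    _ = eLpNorm ψ q volume ^ 2 := by
        rw [← ENNReal.rpow_mul, hq, div_mul_cancel₀ _ hexp.ne', ENNReal.rpow_two]
    _ ≤ (S * eLpNorm (fderiv ℝ ψ) 2 volume) ^ 2 := by gcongr; exact hsob
    _ = (S : ℝ≥0∞) ^ 2 * eLpNorm (fderiv ℝ ψ) 2 volume ^ 2 := mul_pow _ _ _
    _ ≤ ENNReal.ofReal ((S + 1 : ℝ) ^ 2) * (ENNReal.ofReal (2 * M / a) ^ 2 *
      ∫⁻ x in {x | a < ‖φ x‖ ∧ ‖φ x‖ < 2 * a}, ‖fderiv ℝ φ x‖ₑ ^ 2) := by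
        gcongr
        rw [ENNReal.ofReal_pow (by positivity)]
        gcongr
        rw [← ENNReal.ofReal_coe_nnreal]
        gcongr
        linarith
    _ = _ := by
        rw [← mul_assoc, ← ENNReal.ofReal_pow (by positivity), ← ENNReal.ofReal_mul (by positivity)]
        congr 2
        rw [div_pow]; ring

/-- Maz'ya's truncation method. On `U k` one has `|φ|² < 16 a_k²`, while the `w`-mass is at most `K
C / a_k²` times the gradient integral over `T k`. The powers of `a_k` cancel, and the disjoint `T k`
sum to at most the whole gradient integral. -/
lemma exists_lintegral_mul_enorm_sq_le {n : ℕ} (hn : 3 ≤ n) :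
    ∃ C : ℝ, 0 < C ∧ ∀ (w : Rn n → ℝ≥0∞), AEMeasurable w volume → ∀ K : ℝ≥0∞,
      (∀ E, ∫⁻ x in E, w x ≤ K * volume E ^ (1 - 2 / (n : ℝ))) →
      ∀ (φ : Rn n → ℂ), ContDiff ℝ 1 φ → HasCompactSupport φ →
        ∫⁻ x, w x * ‖φ x‖ₑ ^ 2 ≤ ENNReal.ofReal C * K * ∫⁻ x, ‖fderiv ℝ φ x‖ₑ ^ 2 := by
  obtain ⟨C, hC, hlev⟩ := exists_volume_level_rpow_le hn
  refine ⟨16 * C, by positivity, fun w hw K hK φ hφ hc => ?_⟩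
  have hm : Measurable fun x => ‖φ x‖ := hφ.continuous.norm.measurable
  set a : ℤ → ℝ := fun k => 2 ^ k with ha
  have ha0 : ∀ k, 0 < a k := fun k => by positivity
  have hasucc : ∀ k, a (k + 1) = 2 * a k := fun k => by
    simp only [ha]; rw [zpow_add₀ two_ne_zero, zpow_one, mul_comm]
  set T : ℤ → Set (Rn n) := fun k => {x | a k < ‖φ x‖ ∧ ‖φ x‖ < 2 * a k}
  -- `U k` lies one dyadic step above `T k`: the cutoff built on `T k` has already reached `1`
  -- there. The closed lower end lets the `U k` cover `φ ≠ 0`.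
  set U : ℤ → Set (Rn n) := fun k => {x | 2 * a k ≤ ‖φ x‖ ∧ ‖φ x‖ < 4 * a k}
  have hT : ∀ k, MeasurableSet (T k) := fun k =>
    (measurableSet_lt measurable_const hm).inter (measurableSet_lt hm measurable_const)
  have hU : ∀ k, MeasurableSet (U k) := fun k =>
    (measurableSet_le measurable_const hm).inter (measurableSet_lt hm measurable_const)
  have hTdisj : Pairwise (Function.onFun Disjoint T) := by
    have aux : ∀ j k, j < k → Disjoint (T j) (T k) := fun j k hjk => by
      refine Set.disjoint_left.2 fun x hx hx' => ?_
      have : a (j + 1) ≤ a k := zpow_le_zpow_right₀ one_le_two (by omega)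
      rw [hasucc] at this
      linarith [hx.2, hx'.1]
    intro j k hjk
    rcases lt_or_gt_of_ne hjk with h | h
    · exact aux _ _ h
    · exact (aux _ _ h).symm
  have hcover : ∀ x, w x * ‖φ x‖ₑ ^ 2 ≤ ∑' k, (U k).indicator (fun x => w x * ‖φ x‖ₑ ^ 2) x := by
    intro x
    by_cases hx : φ x = 0
    · simp [hx]
    · obtain ⟨k, hk1, hk2⟩ := exists_mem_Ico_zpow (norm_pos_iff.2 hx) (one_lt_two (α := ℝ))
      have hmem : x ∈ U (k - 1) := by
        have h1 : (2 : ℝ) ^ k = 2 * a (k - 1) := by rw [← hasucc]; simp [ha]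
        have h2 : (2 : ℝ) ^ (k + 1) = 4 * a (k - 1) := by
          rw [zpow_add₀ two_ne_zero, h1]; ring
        exact ⟨h1 ▸ hk1, h2 ▸ hk2⟩
      refine le_trans ?_ (ENNReal.le_tsum (k - 1))
      rw [Set.indicator_of_mem hmem]
  have hpiece : ∀ k, ∫⁻ x in U k, w x * ‖φ x‖ₑ ^ 2 ≤
      ENNReal.ofReal (16 * C) * K * ∫⁻ x in T k, ‖fderiv ℝ φ x‖ₑ ^ 2 := by
    intro k
    calc ∫⁻ x in U k, w x * ‖φ x‖ₑ ^ 2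
        ≤ ∫⁻ x in U k, w x * ENNReal.ofReal (4 * a k) ^ 2 := by
          refine setLIntegral_mono_ae' (hU k) (Eventually.of_forall fun x hx => ?_)
          gcongr
          rw [← ofReal_norm]
          exact ENNReal.ofReal_le_ofReal hx.2.le
      _ = (∫⁻ x in U k, w x) * ENNReal.ofReal (4 * a k) ^ 2 :=
          lintegral_mul_const' _ _ (ENNReal.pow_ne_top ENNReal.ofReal_ne_top)
      _ ≤ (∫⁻ x in {x | 2 * a k ≤ ‖φ x‖}, w x) * ENNReal.ofReal (4 * a k) ^ 2 := by
          gcongr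
          exact fun _ h => h.1
      _ ≤ (K * (ENNReal.ofReal (C / a k ^ 2) * ∫⁻ x in T k, ‖fderiv ℝ φ x‖ₑ ^ 2)) *
          ENNReal.ofReal (4 * a k) ^ 2 := by
          gcongr
          refine (hK _).trans ?_
          gcongr
          exact hlev φ hφ hc _ (ha0 k)
      _ = (ENNReal.ofReal (C / a k ^ 2) * ENNReal.ofReal (4 * a k) ^ 2) * K *
          ∫⁻ x in T k, ‖fderiv ℝ φ x‖ₑ ^ 2 := by ring
      _ = _ := by
          rw [← ENNReal.ofReal_pow (by positivity), ← ENNReal.ofReal_mul (by positivity)]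
          congr 3
          have := (ha0 k).ne'
          field_simp
          norm_num
  calc ∫⁻ x, w x * ‖φ x‖ₑ ^ 2
      ≤ ∫⁻ x, ∑' k, (U k).indicator (fun x => w x * ‖φ x‖ₑ ^ 2) x := lintegral_mono hcover
    _ = ∑' k, ∫⁻ x in U k, w x * ‖φ x‖ₑ ^ 2 := by
        rw [lintegral_tsum]
        · simp only [lintegral_indicator (hU _)]
        · exact fun k => (hw.mul (hφ.continuous.enorm.measurable.pow_const
            2).aemeasurable).indicator
            (hU k)
    _ ≤ ∑' k, ENNReal.ofReal (16 * C) * K * ∫⁻ x in T k, ‖fderiv ℝ φ x‖ₑ ^ 2 :=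
        ENNReal.tsum_le_tsum hpiece
    _ = ENNReal.ofReal (16 * C) * K * ∫⁻ x in ⋃ k, T k, ‖fderiv ℝ φ x‖ₑ ^ 2 := by
        rw [ENNReal.tsum_mul_left, lintegral_iUnion hT hTdisj]
    _ ≤ _ := by
        gcongr
        exact Measure.restrict_le_self

/-! ### Mollification in `L²` -/

lemma eLpNorm_two_sq {α F : Type*} [MeasurableSpace α] [NormedAddCommGroup F] (f : α → F)
    (μ : Measure α) : eLpNorm f 2 μ ^ 2 = ∫⁻ x, ‖f x‖ₑ ^ 2 ∂μ := by
  rw [eLpNorm_eq_lintegral_rpow_enorm_toReal two_ne_zero ENNReal.ofNat_ne_top, ENNReal.toReal_ofNat,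
    ← ENNReal.rpow_two, ← ENNReal.rpow_mul, one_div_mul_cancel two_ne_zero, ENNReal.rpow_one]
  simp only [ENNReal.rpow_two]

lemma eLpNorm_two_le_of_lintegral_le {α F : Type*} [MeasurableSpace α] [NormedAddCommGroup F]
    {f : α → F} {μ : Measure α} {c : ℝ≥0∞} (h : ∫⁻ x, ‖f x‖ₑ ^ 2 ∂μ ≤ c ^ 2) :
    eLpNorm f 2 μ ≤ c := by
  rw [← eLpNorm_two_sq] at h
  exact (ENNReal.pow_le_pow_left_iff two_ne_zero).1 h

/-- Strong continuity of translations on `L²`. -/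
lemma eventually_lintegral_translate_sub_le {n : ℕ} (u : L2 n) {δ : ℝ≥0∞} (hδ : δ ≠ 0) :
    ∀ᶠ y : Rn n in 𝓝 0, ∫⁻ x, ‖u (x - y) - u x‖ₑ ^ 2 ≤ δ ^ 2 := by
  have hmp : ∀ y : Rn n, MeasurePreserving (fun x => x - y) (volume : Measure (Rn n)) volume :=
    fun y => measurePreserving_sub_right volume y
  let g : C(Rn n, C(Rn n, Rn n)) := (ContinuousMap.mk (fun p : Rn n × Rn n => p.2 - p.1)
    (continuous_snd.sub continuous_fst)).curry
  have hcont := Continuous.compMeasurePreservingLp (μ := (volume : Measure (Rn n))) (p := 2)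
    (f := fun _ : Rn n => u) continuous_const g.continuous hmp ENNReal.ofNat_ne_top
  have hev := (EMetric.tendsto_nhds.1 (hcont.tendsto 0)) δ (pos_iff_ne_zero.2 hδ)
  filter_upwards [hev] with y hy
  rw [Lp.edist_def] at hy
  rw [← eLpNorm_two_sq]
  gcongr
  refine le_trans (le_of_eq (eLpNorm_congr_ae ?_)) hy.le
  have h1 := Lp.coeFn_compMeasurePreserving u (hmp y)
  have h2 := Lp.coeFn_compMeasurePreserving u (hmp 0)
  filter_upwards [h1, h2] with x hx1 hx2
  have e1 : (Lp.compMeasurePreserving (g y) (hmp y) u : L2 n) x = u (x - y) := hx1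
  have e2 : (Lp.compMeasurePreserving (g 0) (hmp 0) u : L2 n) x = u x := by
    refine hx2.trans ?_
    simp
  simp only [Pi.sub_apply]
  rw [e1, e2]

/-- The convolution `ρ * u`. -/
noncomputable def mollify {n : ℕ} (ρ : Rn n → ℝ) (u : L2 n) (x : Rn n) : ℂ :=
  ∫ t, u t * (ρ (x - t) : ℂ)

/-- The error of mollification is an average of `u (· - y) - u` over the probability measure `ρ dy`;
Jensen's inequality moves the square inside and Tonelli integrates in `x` first. -/
lemma lintegral_mollify_sub_le {n : ℕ} (u : L2 n) {ρ : Rn n → ℝ} (hρ : Continuous ρ)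
    (hc : HasCompactSupport ρ) (h0 : ∀ x, 0 ≤ ρ x) (h1 : ∫ x, ρ x = 1) {c : ℝ≥0∞}
    (hu : ∀ y, ρ y ≠ 0 → ∫⁻ x, ‖u (x - y) - u x‖ₑ ^ 2 ≤ c) :
    ∫⁻ x, ‖mollify ρ u x - u x‖ₑ ^ 2 ≤ c := by
  have hmu : Measurable u := (Lp.stronglyMeasurable u).measurable
  have hmρ : Measurable fun y => ENNReal.ofReal (ρ y) := hρ.measurable.ennreal_ofReal
  set ν : Measure (Rn n) := volume.withDensity fun y => ENNReal.ofReal (ρ y) with hν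
  have hmass : ∫⁻ y, ENNReal.ofReal (ρ y) = 1 := by
    rw [← ofReal_integral_eq_lintegral_ofReal (hρ.integrable_of_hasCompactSupport hc)
      (Eventually.of_forall h0), h1, ENNReal.ofReal_one]
  have hprob : IsProbabilityMeasure ν := ⟨by rw [hν, withDensity_apply _ .univ]; simpa using hmass⟩
  have hρ2 : MemLp (fun y => (ρ y : ℂ)) 2 volume :=
    (Complex.continuous_ofReal.comp hρ).memLp_of_hasCompactSupport
      (hc.comp_left (g := fun r : ℝ => (r : ℂ)) (by simp))
  have hint : ∀ x, Integrable (fun y => u (x - y)) ν := fun x => by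
    rw [hν, integrable_withDensity_iff_integrable_smul' hmρ (by simp)]
    have hshift : MemLp (fun y => u (x - y)) 2 volume :=
      (Lp.memLp u).comp_measurePreserving (Measure.measurePreserving_sub_left volume x)
    refine (hρ2.integrable_mul hshift).congr (Eventually.of_forall fun y => ?_)
    simp [ENNReal.toReal_ofReal (h0 y)]
  have hmol : ∀ x, mollify ρ u x - u x = ∫ y, (u (x - y) - u x) ∂ν := fun x => by
    rw [integral_sub (hint x) (integrable_const _), integral_const, probReal_univ, one_smul,
      hν, integral_withDensity_eq_integral_toReal_smul hmρ (by simp), mollify,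
      ← integral_sub_left_eq_self _ _ x]
    congr 1
    refine integral_congr_ae (Eventually.of_forall fun y => ?_)
    simp [ENNReal.toReal_ofReal (h0 y), mul_comm]
  have hjensen : ∀ x, ‖mollify ρ u x - u x‖ₑ ^ 2 ≤ ∫⁻ y, ‖u (x - y) - u x‖ₑ ^ 2 ∂ν := fun x => by
    rw [hmol, ← eLpNorm_two_sq]
    gcongr
    refine (enorm_integral_le_lintegral_enorm _).trans ?_
    rw [← eLpNorm_one_eq_lintegral_enorm]
    exact eLpNorm_le_eLpNorm_of_exponent_le one_le_two
      ((hint x).sub (integrable_const _)).aestronglyMeasurable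
  have hjoint : Measurable (Function.uncurry fun x y : Rn n => ‖u (x - y) - u x‖ₑ ^ 2) :=
    (((hmu.comp (measurable_fst.sub measurable_snd)).sub
        (hmu.comp measurable_fst)).enorm).pow_const 2
  calc ∫⁻ x, ‖mollify ρ u x - u x‖ₑ ^ 2
      ≤ ∫⁻ x, ∫⁻ y, ‖u (x - y) - u x‖ₑ ^ 2 ∂ν := lintegral_mono hjensen
    _ = ∫⁻ y, (∫⁻ x, ‖u (x - y) - u x‖ₑ ^ 2) ∂ν := by
        rw [lintegral_lintegral_swap hjoint.aemeasurable]
    _ = ∫⁻ y, ENNReal.ofReal (ρ y) * ∫⁻ x, ‖u (x - y) - u x‖ₑ ^ 2 := by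
        rw [hν, lintegral_withDensity_eq_lintegral_mul _ hmρ]
        · rfl
        · exact (hjoint.comp measurable_swap).lintegral_prod_right'
    _ ≤ ∫⁻ y, ENNReal.ofReal (ρ y) * c := by
        refine lintegral_mono fun y => ?_
        by_cases hy : ρ y = 0
        · simp [hy]
        · gcongr
          exact hu y hy
    _ = c := by rw [lintegral_mul_const _ hmρ, hmass, one_mul]

lemma mollify_eq_convolution {n : ℕ} (ρ : Rn n → ℝ) (u : L2 n) :
    mollify ρ u = convolution u (fun x => (ρ x : ℂ)) (ContinuousLinearMap.mul ℝ ℂ) volume := rfl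

lemma locallyIntegrable_L2 {n : ℕ} (u : L2 n) : LocallyIntegrable u volume :=
  (Lp.memLp u).locallyIntegrable (by norm_num)

section Mollify

variable {n : ℕ} {ρ : Rn n → ℝ}

lemma isTest_ofReal (hρ : ContDiff ℝ ∞ ρ) (hc : HasCompactSupport ρ) :
    IsTest fun x => (ρ x : ℂ) :=
  ⟨Complex.ofRealCLM.contDiff.comp hρ, hc.comp_left (g := fun r : ℝ => (r : ℂ)) (by simp)⟩

lemma contDiff_mollify (hρ : ContDiff ℝ ∞ ρ) (hc : HasCompactSupport ρ) (u : L2 n) :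
    ContDiff ℝ ∞ (mollify ρ u) := by
  rw [mollify_eq_convolution]
  exact (isTest_ofReal hρ hc).compact.contDiff_convolution_right (n := ⊤) _ (locallyIntegrable_L2 u)
    (isTest_ofReal hρ hc).smooth

/-- The derivative falls on `ρ`. As a function of `t`, `ρ (x - t)` is a test function, and its
reflected sign cancels the sign in the weak derivative. -/
lemma pderiv_mollify (hρ : ContDiff ℝ ∞ ρ) (hc : HasCompactSupport ρ) {j : Fin n} {u g : L2 n}
    (hg : HasWeakPartial j u g) : pderiv j (mollify ρ u) = mollify ρ g := by
  have ht := isTest_ofReal hρ hc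
  ext x
  have htx : IsTest fun t => (ρ (x - t) : ℂ) :=
    ⟨ht.smooth.comp (contDiff_const.sub contDiff_id), by
      have := ht.compact.comp_homeomorph (Homeomorph.subLeft x)
      exact this⟩
  have hd : ∀ t, pderiv j (fun t => (ρ (x - t) : ℂ)) t = -pderiv j (fun x => (ρ x : ℂ))
      (x - t) := by
    intro t
    have h1 : HasFDerivAt (fun x => (ρ x : ℂ)) (fderiv ℝ (fun x => (ρ x : ℂ)) (x - t)) (x - t) :=
      (ht.smooth.differentiable (by simp) _).hasFDerivAt
    have h2 := h1.comp t ((hasFDerivAt_id t).const_sub x)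
    simp only [pderiv]
    erw [h2.fderiv]
    simp
  have hfd := ht.compact.hasFDerivAt_convolution_right (ContinuousLinearMap.mul ℝ ℂ)
    (locallyIntegrable_L2 u) (ht.smooth.of_le (by simp)) x
  rw [← mollify_eq_convolution] at hfd
  rw [pderiv, hfd.fderiv, convolution_precompR_apply _ (locallyIntegrable_L2 u)
    (ht.compact.fderiv (𝕜 := ℝ)) (ht.smooth.continuous_fderiv (by simp))]
  have := hg _ htx
  simp only [hd, mul_neg, integral_neg, neg_inj] at this
  exact this

end Mollify

lemma exists_contDiff_approx {n : ℕ} (u : H1 n) {c : ℝ≥0∞} (hc : c ≠ 0) :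
    ∃ v : Rn n → ℂ, ContDiff ℝ ∞ v ∧ eLpNorm (fun x => v x - (u : L2 n) x) 2 volume ≤ c ∧
      ∀ j, eLpNorm (fun x => pderiv j v x - weakPartial u j x) 2 volume ≤ c := by
  have hev : ∀ᶠ y : Rn n in 𝓝 0, (∫⁻ x, ‖(u : L2 n) (x - y) - (u : L2 n) x‖ₑ ^ 2 ≤ c ^ 2) ∧
      ∀ j, ∫⁻ x, ‖weakPartial u j (x - y) - weakPartial u j x‖ₑ ^ 2 ≤ c ^ 2 :=
    (eventually_lintegral_translate_sub_le _ hc).and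
      (eventually_all.2 fun j => eventually_lintegral_translate_sub_le _ hc)
  obtain ⟨r, hr, hball⟩ := Metric.eventually_nhds_iff_ball.1 hev
  let f : ContDiffBump (0 : Rn n) := ⟨r / 2, r, by positivity, by linarith⟩
  have hsupp : ∀ y, f.normed volume y ≠ 0 → y ∈ Metric.ball (0 : Rn n) r := fun y hy => by
    have : y ∈ Function.support (f.normed volume) := hy
    rwa [f.support_normed_eq] at this
  have happrox : ∀ g : L2 n, (∀ y, f.normed volume y ≠ 0 → ∫⁻ x, ‖g (x - y) - g x‖ₑ ^ 2 ≤ c ^ 2) →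
      eLpNorm (fun x => mollify (f.normed volume) g x - g x) 2 volume ≤ c := fun g hg =>
    eLpNorm_two_le_of_lintegral_le (lintegral_mollify_sub_le g f.continuous_normed
      f.hasCompactSupport_normed f.nonneg_normed f.integral_normed hg)
  refine ⟨mollify (f.normed volume) u, contDiff_mollify f.contDiff_normed
    f.hasCompactSupport_normed u, happrox _ fun y hy => (hball y (hsupp y hy)).1, fun j => ?_⟩
  rw [pderiv_mollify f.contDiff_normed f.hasCompactSupport_normed (weakPartial_spec u j)]
  exact happrox _ fun y hy => (hball y (hsupp y hy)).2 j

/-! ### Truncation in space -/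

lemma tendsto_eLpNorm_two_of_dominated {α F : Type*} [MeasurableSpace α] [NormedAddCommGroup F]
    {μ : Measure α} {f : ℕ → α → F} {b : α → ℝ} (hf : ∀ k, AEStronglyMeasurable (f k) μ)
    (hb : MemLp b 2 μ) (hfb : ∀ k x, ‖f k x‖ ≤ b x)
    (hlim : ∀ x, Tendsto (fun k => f k x) atTop (𝓝 0)) :
    Tendsto (fun k => eLpNorm (f k) 2 μ) atTop (𝓝 0) := by
  have key : Tendsto (fun k => eLpNorm (f k) 2 μ ^ 2) atTop (𝓝 0) := by
    simp only [eLpNorm_two_sq]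
    have := tendsto_lintegral_of_dominated_convergence' (μ := μ) (F := fun k x => ‖f k x‖ₑ ^ 2)
      (f := fun _ => 0) (fun x => ‖b x‖ₑ ^ 2) (fun k => (hf k).enorm.pow_const 2)
      (fun k => Eventually.of_forall fun x => ?_) ?_ (Eventually.of_forall fun x => ?_)
    · simpa using this
    · have : ‖f k x‖ₑ ≤ ‖b x‖ₑ := by
        rw [← ofReal_norm, ← ofReal_norm]
        exact ENNReal.ofReal_le_ofReal ((hfb k x).trans (le_abs_self _))
      exact pow_le_pow_left' this 2
    · rw [← eLpNorm_two_sq]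
      exact ENNReal.pow_ne_top hb.eLpNorm_ne_top
    · have h1 : Tendsto (fun k => ‖f k x‖ₑ) atTop (𝓝 0) := by
        simpa using (hlim x).enorm
      simpa [Function.comp_def] using (ENNReal.continuous_pow 2).tendsto 0 |>.comp h1
  have h2 := (ENNReal.continuous_rpow_const (y := 1 / 2)).tendsto 0 |>.comp key
  simp only [Function.comp_def, ← ENNReal.rpow_two, ← ENNReal.rpow_mul] at h2
  simpa using h2

lemma continuous_pderiv {n : ℕ} {v : Rn n → ℂ} (hv : ContDiff ℝ ∞ v) (j : Fin n) :
    Continuous (pderiv j v) :=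
  (hv.continuous_fderiv (by simp)).clm_apply continuous_const

/-- Multiply by the dilated bumps `χ (x / (k + 1))`. Their values and gradients are uniformly
bounded, which gives an `L²` majorant for dominated convergence. -/
lemma exists_isTest_approx_of_contDiff {n : ℕ} {v : Rn n → ℂ} (hv : ContDiff ℝ ∞ v)
    (hv2 : MemLp v 2 volume) (hv2' : ∀ j, MemLp (pderiv j v) 2 volume) {c : ℝ≥0∞} (hc : c ≠ 0) :
    ∃ φ : Rn n → ℂ, IsTest φ ∧ eLpNorm (fun x => φ x - v x) 2 volume ≤ c ∧
      ∀ j, eLpNorm (fun x => pderiv j φ x - pderiv j v x) 2 volume ≤ c := by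
  let χ : ContDiffBump (0 : Rn n) := ⟨1, 2, one_pos, one_lt_two⟩
  let s : ℕ → ℝ := fun k => ((k : ℝ) + 1)⁻¹
  have hs0 : ∀ k, 0 < s k := fun k => by positivity
  have hs1 : ∀ k, s k ≤ 1 := fun k => inv_le_one_of_one_le₀ (by simp)
  let θ : ℕ → Rn n → ℂ := fun k x => (χ (s k • x) : ℂ)
  have hχt : IsTest fun x => (χ x : ℂ) := isTest_ofReal χ.contDiff χ.hasCompactSupport
  obtain ⟨M, hM⟩ := (hχt.smooth.continuous_fderiv (by simp)).bounded_above_of_compact_support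
    (hχt.compact.fderiv (𝕜 := ℝ))
  have hθt : ∀ k, IsTest (θ k) := fun k =>
    ⟨hχt.smooth.comp (contDiff_const_smul (s k)),
      hχt.compact.comp_homeomorph (Homeomorph.smulOfNeZero (s k) (hs0 k).ne')⟩
  have hθ1 : ∀ k x, ‖θ k x‖ ≤ 1 := fun k x => by
    simpa [θ, abs_of_nonneg χ.nonneg] using χ.le_one
  have hθ' : ∀ k j x, ‖pderiv j (θ k) x‖ ≤ M := fun k j x => by
    have h1 : HasFDerivAt (fun x => (χ x : ℂ)) (fderiv ℝ (fun x => (χ x : ℂ)) (s k • x))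
        (s k • x) :=
      (hχt.smooth.differentiable (by simp) _).hasFDerivAt
    have h2 : HasFDerivAt (θ k) _ x := h1.comp x ((hasFDerivAt_id x).const_smul (s k))
    rw [pderiv, h2.fderiv]
    calc _ = ‖s k • fderiv ℝ (fun x => (χ x : ℂ)) (s k • x) (EuclideanSpace.single j 1)‖ := by simp
      _ ≤ 1 * ‖fderiv ℝ (fun x => (χ x : ℂ)) (s k • x) (EuclideanSpace.single j 1)‖ := by
          rw [norm_smul, Real.norm_of_nonneg (hs0 k).le]
          gcongr
          exact hs1 k
      _ ≤ 1 * (M * 1) := by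
          gcongr
          refine (ContinuousLinearMap.le_of_opNorm_le _ (hM _) _).trans_eq ?_
          simp
      _ = M := by ring
  let φ : ℕ → Rn n → ℂ := fun k x => θ k x * v x
  have hφt : ∀ k, IsTest (φ k) := fun k =>
    ⟨(hθt k).smooth.mul hv, (hθt k).compact.mul_right⟩
  -- Equality on a neighbourhood, not just at the point, so that the derivatives also agree
  -- eventually.
  have hev : ∀ x, ∀ᶠ k in atTop, φ k =ᶠ[𝓝 x] v := fun x => by
    obtain ⟨N, hN⟩ := exists_nat_gt ‖x‖
    filter_upwards [eventually_ge_atTop N] with k hk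
    have hnear : ∀ᶠ y in 𝓝 x, ‖y‖ < N := continuous_norm.continuousAt.eventually_lt_const hN
    filter_upwards [hnear] with y hy
    have hle : ‖s k • y‖ ≤ 1 := by
      have : (N : ℝ) ≤ k := by exact_mod_cast hk
      rw [norm_smul, Real.norm_of_nonneg (hs0 k).le, inv_mul_le_one₀ (by positivity)]
      linarith
    have : χ (s k • y) = 1 := χ.one_of_mem_closedBall (by simpa [χ] using hle)
    simp [φ, θ, this]
  have hpd : ∀ k j x, pderiv j (φ k) x = θ k x * pderiv j v x + v x * pderiv j (θ k) x := by
    intro k j x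
    have h := ((hθt k).smooth.differentiable (by simp) x).hasFDerivAt.mul
      (hv.differentiable (by simp) x).hasFDerivAt
    have h' : HasFDerivAt (φ k) _ x := h
    rw [pderiv, h'.fderiv]
    simp [pderiv]
  have lim0 : Tendsto (fun k => eLpNorm (fun x => φ k x - v x) 2 volume) atTop (𝓝 0) := by
    refine tendsto_eLpNorm_two_of_dominated (b := fun x => 2 * ‖v x‖)
      (fun k => ((hφt k).smooth.continuous.sub hv.continuous).aestronglyMeasurable)
      (hv2.norm.const_mul 2) (fun k x => ?_) fun x => ?_
    · refine (norm_sub_le _ _).trans ?_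
      have := mul_le_mul_of_nonneg_right (hθ1 k x) (norm_nonneg (v x))
      simp only [φ, norm_mul]
      linarith
    · refine tendsto_const_nhds.congr' ?_
      filter_upwards [hev x] with k hk
      rw [hk.eq_of_nhds, sub_self]
  have lim1 : ∀ j, Tendsto (fun k => eLpNorm (fun x => pderiv j (φ k) x - pderiv j v x) 2 volume)
      atTop (𝓝 0) := fun j => by
    refine tendsto_eLpNorm_two_of_dominated (b := fun x => 2 * ‖pderiv j v x‖ + M * ‖v x‖)
      (fun k => ((continuous_pderiv (hφt k).smooth j).sub
        (continuous_pderiv hv j)).aestronglyMeasurable)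
      (((hv2' j).norm.const_mul 2).add (hv2.norm.const_mul M)) (fun k x => ?_) fun x => ?_
    · rw [hpd]
      refine (norm_sub_le _ _).trans ((add_le_add_left (norm_add_le _ _) _).trans ?_)
      have h1 := mul_le_mul_of_nonneg_right (hθ1 k x) (norm_nonneg (pderiv j v x))
      have h2 := mul_le_mul_of_nonneg_right (hθ' k j x) (norm_nonneg (v x))
      rw [norm_mul, norm_mul]
      linarith
    · refine tendsto_const_nhds.congr' ?_
      filter_upwards [hev x] with k hk
      rw [pderiv, pderiv, hk.fderiv_eq, sub_self]
  have hpos : 0 < c := pos_iff_ne_zero.2 hc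
  obtain ⟨k, hk0, hk1⟩ := ((lim0.eventually_le_const hpos).and
    (eventually_all.2 fun j => (lim1 j).eventually_le_const hpos)).exists
  exact ⟨φ k, hφt k, hk0, hk1⟩

lemma exists_isTest_approx {n : ℕ} (u : H1 n) {c : ℝ≥0∞} (hc : c ≠ 0) :
    ∃ φ : Rn n → ℂ, IsTest φ ∧ eLpNorm (fun x => φ x - (u : L2 n) x) 2 volume ≤ c ∧
      ∀ j, eLpNorm (fun x => pderiv j φ x - weakPartial u j x) 2 volume ≤ c := by
  -- Half of `c` for the triangle inequality; the cap `1` keeps the error finite even for `c = ⊤`,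
  -- so that the smooth approximant and its partial derivatives are in `L²`.
  have hd0 : min (c / 2) 1 ≠ 0 := by simp [hc]
  have hdt : min (c / 2) 1 < ⊤ := (min_le_right _ _).trans_lt ENNReal.one_lt_top
  obtain ⟨v, hv, hv0, hv1⟩ := exists_contDiff_approx u hd0
  have hmem : ∀ (f : Rn n → ℂ) (g : L2 n), Continuous f →
      eLpNorm (fun x => f x - g x) 2 volume ≤ min (c / 2) 1 → MemLp f 2 volume := by
    intro f g hf h
    have hsub : MemLp (fun x => f x - g x) 2 volume :=
      ⟨hf.aestronglyMeasurable.sub (Lp.aestronglyMeasurable g), h.trans_lt hdt⟩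
    refine (hsub.add (Lp.memLp g)).ae_eq (Eventually.of_forall fun x => ?_)
    simp
  obtain ⟨φ, hφ, hφ0, hφ1⟩ := exists_isTest_approx_of_contDiff hv (hmem v u hv.continuous hv0)
    (fun j => hmem _ _ (continuous_pderiv hv j) (hv1 j)) hd0
  have htri : ∀ (f g : Rn n → ℂ) (h : L2 n), Continuous f → Continuous g →
      eLpNorm (fun x => f x - g x) 2 volume ≤ min (c / 2) 1 →
      eLpNorm (fun x => g x - h x) 2 volume ≤ min (c / 2) 1 →
      eLpNorm (fun x => f x - h x) 2 volume ≤ c := by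
    intro f g h hf hg h1 h2
    have e : (fun x => f x - h x) = (fun x => f x - g x) + fun x => g x - h x := by
      ext x; simp
    rw [e]
    refine (eLpNorm_add_le (hf.aestronglyMeasurable.sub hg.aestronglyMeasurable)
      (hg.aestronglyMeasurable.sub (Lp.aestronglyMeasurable h)) one_le_two).trans ?_
    refine (add_le_add (h1.trans (min_le_left _ _)) (h2.trans (min_le_left _ _))).trans_eq ?_
    exact ENNReal.add_halves c
  exact ⟨φ, hφ, htri _ v _ hφ.smooth.continuous hv.continuous hφ0 hv0, fun j =>
    htri _ (pderiv j v) _ (continuous_pderiv hφ.smooth j) (continuous_pderiv hv j) (hφ1 j) (hv1 j)⟩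

/-! ### Test functions in `H¹` -/

lemma IsTest.hasWeakPartial {n : ℕ} {φ : Rn n → ℂ} (hφ : IsTest φ) (j : Fin n) :
    HasWeakPartial j (hφ.memLp.toLp φ) ((hφ.memLp_pderiv j).toLp (pderiv j φ)) := by
  intro η hη
  have e1 : ∫ x, (hφ.memLp.toLp φ) x * pderiv j η x = ∫ x, φ x * pderiv j η x :=
    integral_congr_ae (hφ.memLp.coeFn_toLp.mono fun x hx => by simp only [hx])
  have e2 : ∫ x, ((hφ.memLp_pderiv j).toLp (pderiv j φ)) x * η x = ∫ x, pderiv j φ x * η x :=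
    integral_congr_ae ((hφ.memLp_pderiv j).coeFn_toLp.mono fun x hx => by simp only [hx])
  rw [e1, e2]
  exact integral_mul_fderiv_eq_neg_fderiv_mul_of_integrable
    ((hφ.memLp_pderiv j).integrable_mul hη.memLp) (hφ.memLp.integrable_mul (hη.memLp_pderiv j))
    (hφ.memLp.integrable_mul hη.memLp) (fun x _ => hφ.smooth.differentiable (by simp) x)
    (fun x _ => hη.smooth.differentiable (by simp) x)

/-- A test function as an element of `H¹`. -/
noncomputable def IsTest.toH1 {n : ℕ} {φ : Rn n → ℂ} (hφ : IsTest φ) : H1 n :=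
  ⟨hφ.memLp.toLp φ, fun j => ⟨_, hφ.hasWeakPartial j⟩⟩

section H1

variable {n : ℕ}

lemma IsTest.coeFn_toH1 {φ : Rn n → ℂ} (hφ : IsTest φ) : (hφ.toH1 : L2 n) =ᵐ[volume] φ :=
  hφ.memLp.coeFn_toLp

lemma HasWeakPartial.weakPartial_eq {u : H1 n} {j : Fin n} {g : L2 n}
    (h : HasWeakPartial j (u : L2 n) g) : weakPartial u j = g :=
  (weakPartial_spec u j).unique h

lemma IsTest.weakPartial_toH1 {φ : Rn n → ℂ} (hφ : IsTest φ) (j : Fin n) :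
    weakPartial hφ.toH1 j = (hφ.memLp_pderiv j).toLp (pderiv j φ) :=
  HasWeakPartial.weakPartial_eq (hφ.hasWeakPartial j)

lemma IsTest.coeFn_weakPartial_toH1 {φ : Rn n → ℂ} (hφ : IsTest φ) (j : Fin n) :
    weakPartial hφ.toH1 j =ᵐ[volume] pderiv j φ := by
  rw [hφ.weakPartial_toH1]
  exact (hφ.memLp_pderiv j).coeFn_toLp

lemma weakPartial_add (u v : H1 n) (j : Fin n) :
    weakPartial (u + v) j = weakPartial u j + weakPartial v j :=
  HasWeakPartial.weakPartial_eq ((weakPartial_spec u j).add (weakPartial_spec v j))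

lemma weakPartial_smul (c : ℂ) (u : H1 n) (j : Fin n) :
    weakPartial (c • u) j = c • weakPartial u j :=
  HasWeakPartial.weakPartial_eq ((weakPartial_spec u j).smul c)

lemma weakPartial_sub (u v : H1 n) (j : Fin n) :
    weakPartial (u - v) j = weakPartial u j - weakPartial v j := by
  rw [sub_eq_add_neg, ← neg_one_smul ℂ v, weakPartial_add, weakPartial_smul, neg_one_smul,
    sub_eq_add_neg]

/-- The squared `L²` norm of the weak gradient. -/
noncomputable def gradSq (u : H1 n) : ℝ := ∑ j, ‖weakPartial u j‖ ^ 2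

lemma gradSq_nonneg (u : H1 n) : 0 ≤ gradSq u := Finset.sum_nonneg fun _ _ => by positivity

lemma norm_le_of_eLpNorm_sub_le {f g : L2 n} {φ : Rn n → ℂ} (hf : f =ᵐ[volume] φ) {c : ℝ}
    (hc : 0 ≤ c) (h : eLpNorm (fun x => φ x - g x) 2 volume ≤ ENNReal.ofReal c) : ‖f - g‖ ≤ c := by
  rw [Lp.norm_def]
  refine ENNReal.toReal_le_of_le_ofReal hc ((eLpNorm_congr_ae ?_).trans_le h)
  filter_upwards [Lp.coeFn_sub f g, hf] with x h1 h2
  rw [h1, Pi.sub_apply, h2]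

/-- Test functions are dense in `H¹`. -/
lemma exists_toH1_sub_lt (u : H1 n) {ε : ℝ} (hε : 0 < ε) :
    ∃ (φ : Rn n → ℂ) (hφ : IsTest φ), ‖((u - hφ.toH1 : H1 n) : L2 n)‖ ≤ ε ∧
      ∀ j, ‖weakPartial (u - hφ.toH1) j‖ ≤ ε := by
  obtain ⟨φ, hφ, h0, h1⟩ := exists_isTest_approx u (c := ENNReal.ofReal ε) (by simpa using hε)
  refine ⟨φ, hφ, ?_, fun j => ?_⟩
  · rw [Submodule.coe_sub, norm_sub_rev]
    exact norm_le_of_eLpNorm_sub_le hφ.coeFn_toH1 hε.le h0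
  · rw [weakPartial_sub, norm_sub_rev]
    exact norm_le_of_eLpNorm_sub_le (hφ.coeFn_weakPartial_toH1 j) hε.le (h1 j)

lemma exists_seq_toH1_tendsto (u : H1 n) :
    ∃ (φ : ℕ → Rn n → ℂ) (hφ : ∀ k, IsTest (φ k)),
      Tendsto (fun k => ((hφ k).toH1 : L2 n)) atTop (𝓝 u) ∧
      ∀ j, Tendsto (fun k => weakPartial (hφ k).toH1 j) atTop (𝓝 (weakPartial u j)) := by
  choose φ hφ h0 h1 using fun k : ℕ => exists_toH1_sub_lt u (Nat.one_div_pos_of_nat (α := ℝ)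
      (n := k))
  have hlim := tendsto_one_div_add_atTop_nhds_zero_nat (𝕜 := ℝ)
  refine ⟨φ, hφ, ?_, fun j => ?_⟩
  · refine tendsto_iff_norm_sub_tendsto_zero.2
      (squeeze_zero (fun _ => norm_nonneg _) (fun k => ?_) hlim)
    rw [norm_sub_rev, ← Submodule.coe_sub]
    exact h0 k
  · refine tendsto_iff_norm_sub_tendsto_zero.2
      (squeeze_zero (fun _ => norm_nonneg _) (fun k => ?_) hlim)
    rw [norm_sub_rev, ← weakPartial_sub]
    exact h1 k j

lemma dense_H1 : Dense (H1 n : Set (L2 n)) := by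
  refine (Lp.dense_hasCompactSupport_contDiff (E := Rn n) (F := ℂ) (μ := volume) (p := 2)
    ENNReal.ofNat_ne_top).mono ?_
  rintro f ⟨g, hfg, hc, hg⟩
  have ht : IsTest g := ⟨hg, hc⟩
  have : f = (ht.toH1 : L2 n) := Lp.ext (hfg.trans ht.coeFn_toH1.symm)
  rw [this]
  exact ht.toH1.2

lemma integral_mul_eq_inner (u : L2 n) {f : Rn n → ℂ} (hf : MemLp f 2 volume) :
    ∫ x, u x * f x = inner ℂ (hf.star.toLp (star f)) u := by
  rw [L2.inner_def]
  refine integral_congr_ae ?_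
  filter_upwards [hf.star.coeFn_toLp] with x hx
  simp [hx]

/-- Both sides of the defining identity are `L²` pairings with fixed functions, hence continuous:
weak differentiation is a closed operator. -/
lemma HasWeakPartial.of_tendsto {j : Fin n} {u g : ℕ → L2 n} {v h : L2 n}
    (hug : ∀ k, HasWeakPartial j (u k) (g k)) (hu : Tendsto u atTop (𝓝 v))
    (hg : Tendsto g atTop (𝓝 h)) : HasWeakPartial j v h := by
  intro φ hφ
  have h1 : Tendsto (fun k => ∫ x, u k x * pderiv j φ x) atTop (𝓝 (∫ x, v x * pderiv j φ x)) := by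
    simp only [integral_mul_eq_inner _ (hφ.memLp_pderiv j)]
    exact tendsto_const_nhds.inner hu
  have h2 : Tendsto (fun k => ∫ x, g k x * φ x) atTop (𝓝 (∫ x, h x * φ x)) := by
    simp only [integral_mul_eq_inner _ hφ.memLp]
    exact tendsto_const_nhds.inner hg
  refine tendsto_nhds_unique h1 ?_
  simp only [hug _ φ hφ]
  exact h2.neg

/-- `H¹` is complete. -/
lemma exists_tendsto_H1 (u : ℕ → H1 n) (hu : CauchySeq fun k => (u k : L2 n))
    (hg : ∀ j, CauchySeq fun k => weakPartial (u k) j) :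
    ∃ v : H1 n, Tendsto (fun k => (u k : L2 n)) atTop (𝓝 v) ∧
      ∀ j, Tendsto (fun k => weakPartial (u k) j) atTop (𝓝 (weakPartial v j)) := by
  obtain ⟨v, hv⟩ := cauchySeq_tendsto_of_complete hu
  choose g hg using fun j => cauchySeq_tendsto_of_complete (hg j)
  have hw : ∀ j, HasWeakPartial j v (g j) := fun j =>
    HasWeakPartial.of_tendsto (fun k => weakPartial_spec (u k) j) hv (hg j)
  refine ⟨⟨v, fun j => ⟨g j, hw j⟩⟩, hv, fun j => ?_⟩
  rw [HasWeakPartial.weakPartial_eq (u := ⟨v, fun j => ⟨g j, hw j⟩⟩) (hw j)]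
  exact hg j

/-! ### The Hardy inequality on `H¹` -/

/-- Cauchy–Schwarz. It translates the operator norm in the Sobolev inequality into the partial
derivatives that define `gradSq`. -/
lemma norm_fderiv_sq_le (φ : Rn n → ℂ) (x : Rn n) :
    ‖fderiv ℝ φ x‖ ^ 2 ≤ ∑ j, ‖pderiv j φ x‖ ^ 2 := by
  have hle : ‖fderiv ℝ φ x‖ ≤ √(∑ j, ‖pderiv j φ x‖ ^ 2) := by
    refine ContinuousLinearMap.opNorm_le_bound _ (Real.sqrt_nonneg _) fun y => ?_
    have hy : fderiv ℝ φ x y = ∑ j, y j • pderiv j φ x := by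
      conv_lhs => rw [← (EuclideanSpace.basisFun (Fin n) ℝ).sum_repr y]
      simp [map_sum, pderiv]
    calc ‖fderiv ℝ φ x y‖ ≤ ∑ j, ‖pderiv j φ x‖ * ‖y j‖ := by
          rw [hy]
          refine (norm_sum_le _ _).trans_eq (Finset.sum_congr rfl fun j _ => ?_)
          rw [norm_smul, mul_comm]
      _ ≤ √(∑ j, ‖pderiv j φ x‖ ^ 2) * ‖y‖ := by
          rw [EuclideanSpace.norm_eq, ← Real.sqrt_mul (by positivity)]
          exact Real.le_sqrt_of_sq_le (Finset.sum_mul_sq_le_sq_mul_sq _ _ _)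
  calc ‖fderiv ℝ φ x‖ ^ 2 ≤ √(∑ j, ‖pderiv j φ x‖ ^ 2) ^ 2 := by gcongr
    _ = _ := Real.sq_sqrt (by positivity)

lemma ofReal_norm_sq_eq_lintegral (f : L2 n) : ENNReal.ofReal (‖f‖ ^ 2) = ∫⁻ x, ‖f x‖ₑ ^ 2 := by
  rw [ENNReal.ofReal_pow (norm_nonneg _), ofReal_norm, Lp.enorm_def, eLpNorm_two_sq]

lemma IsTest.lintegral_fderiv_le {φ : Rn n → ℂ} (hφ : IsTest φ) :
    ∫⁻ x, ‖fderiv ℝ φ x‖ₑ ^ 2 ≤ ENNReal.ofReal (gradSq hφ.toH1) := by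
  calc ∫⁻ x, ‖fderiv ℝ φ x‖ₑ ^ 2 ≤ ∫⁻ x, ∑ j, ‖pderiv j φ x‖ₑ ^ 2 := by
        refine lintegral_mono fun x => ?_
        simp only [← ofReal_norm, ← ENNReal.ofReal_pow (norm_nonneg _)]
        rw [← ENNReal.ofReal_sum_of_nonneg fun _ _ => by positivity]
        exact ENNReal.ofReal_le_ofReal (norm_fderiv_sq_le φ x)
    _ = ∑ j, ∫⁻ x, ‖pderiv j φ x‖ₑ ^ 2 := lintegral_finsetSum _ fun j _ =>
        (continuous_pderiv hφ.smooth j).enorm.measurable.pow_const 2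
    _ = ENNReal.ofReal (gradSq hφ.toH1) := by
        rw [gradSq, ENNReal.ofReal_sum_of_nonneg fun _ _ => by positivity]
        refine Finset.sum_congr rfl fun j _ => ?_
        rw [ofReal_norm_sq_eq_lintegral]
        refine lintegral_congr_ae ?_
        filter_upwards [hφ.coeFn_weakPartial_toH1 j] with x hx
        rw [hx]

/-- Fatou along an a.e. convergent subsequence of test functions whose gradients converge in `L²`.
Finiteness of `w` makes multiplication by `w x` continuous on `[0, ∞]`. -/
lemma exists_lintegral_mul_enorm_sq_le_gradSq (hn : 3 ≤ n) :
    ∃ C : ℝ, 0 < C ∧ ∀ (w : Rn n → ℝ≥0∞), AEMeasurable w volume → (∀ x, w x ≠ ⊤) →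
      ∀ K : ℝ, 0 ≤ K →
      (∀ E, ∫⁻ x in E, w x ≤ ENNReal.ofReal K * volume E ^ (1 - 2 / (n : ℝ))) →
      ∀ u : H1 n, ∫⁻ x, w x * ‖(u : L2 n) x‖ₑ ^ 2 ≤ ENNReal.ofReal (C * K * gradSq u) := by
  obtain ⟨C, hC, hhardy⟩ := exists_lintegral_mul_enorm_sq_le hn
  refine ⟨C, hC, fun w hw hwtop K hK0 hK u => ?_⟩
  obtain ⟨φ, hφ, hlim, hglim⟩ := exists_seq_toH1_tendsto u
  obtain ⟨ns, hns, hae⟩ := (tendstoInMeasure_of_tendsto_Lp hlim).exists_seq_tendsto_ae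
  have hbound : ∀ k, ∫⁻ x, w x * ‖((hφ k).toH1 : L2 n) x‖ₑ ^ 2 ≤
      ENNReal.ofReal (C * K * gradSq (hφ k).toH1) := fun k => by
    calc ∫⁻ x, w x * ‖((hφ k).toH1 : L2 n) x‖ₑ ^ 2 = ∫⁻ x, w x * ‖φ k x‖ₑ ^ 2 := by
          refine lintegral_congr_ae ?_
          filter_upwards [(hφ k).coeFn_toH1] with x hx
          rw [hx]
      _ ≤ ENNReal.ofReal C * ENNReal.ofReal K * ∫⁻ x, ‖fderiv ℝ (φ k) x‖ₑ ^ 2 :=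
          hhardy w hw _ hK _ ((hφ k).smooth.of_le (by simp)) (hφ k).compact
      _ ≤ ENNReal.ofReal C * ENNReal.ofReal K * ENNReal.ofReal (gradSq (hφ k).toH1) := by
          gcongr
          exact (hφ k).lintegral_fderiv_le
      _ = _ := by
          rw [ENNReal.ofReal_mul (by positivity), ENNReal.ofReal_mul hC.le]
  have hgrad : Tendsto (fun k => ENNReal.ofReal (C * K * gradSq (hφ (ns k)).toH1)) atTop
      (𝓝 (ENNReal.ofReal (C * K * gradSq u))) := by
    refine ENNReal.tendsto_ofReal (Tendsto.const_mul _ ?_)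
    exact (tendsto_finsetSum _ fun j _ => (hglim j).norm.pow 2).comp hns.tendsto_atTop
  calc ∫⁻ x, w x * ‖(u : L2 n) x‖ₑ ^ 2
      ≤ ∫⁻ x, liminf (fun k => w x * ‖((hφ (ns k)).toH1 : L2 n) x‖ₑ ^ 2) atTop := by
        refine lintegral_mono_ae ?_
        filter_upwards [hae] with x hx
        refine (Tendsto.liminf_eq ?_).ge
        exact ENNReal.Tendsto.const_mul
          (((ENNReal.continuous_pow 2).tendsto _).comp hx.enorm) (Or.inr (hwtop x))
    _ ≤ liminf (fun k => ∫⁻ x, w x * ‖((hφ (ns k)).toH1 : L2 n) x‖ₑ ^ 2) atTop :=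
        lintegral_liminf_le' fun k => hw.mul
          ((Lp.aestronglyMeasurable _).enorm.pow_const 2)
    _ ≤ liminf (fun k => ENNReal.ofReal (C * K * gradSq (hφ (ns k)).toH1)) atTop :=
        liminf_le_liminf (Eventually.of_forall fun k => hbound _)
    _ = _ := hgrad.liminf_eq

end H1

/-! ### The self-adjoint operator of a closed form -/

section SelfAdjoint

variable {K : Type*} [NormedAddCommGroup K] [InnerProductSpace ℂ K] [CompleteSpace K]

/-- Symmetry gives `T ⊆ T*`. For `y'` in the domain of `T*`, choose `x` with `(T + 1) x = (T* + 1)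
y'`; then `y' - x` lies in the kernel of `T* + 1`, which is orthogonal to the range of `T + 1`, that
is, to everything. -/
lemma isSelfAdjoint_of_surjective_add_id {T : K →ₗ.[ℂ] K} (hd : Dense (T.domain : Set K))
    (hsymm : ∀ x y : T.domain, inner ℂ (T x) (y : K) = inner ℂ (x : K) (T y))
    (hsurj : ∀ w : K, ∃ x : T.domain, T x + x = w) : IsSelfAdjoint T := by
  rw [LinearPMap.isSelfAdjoint_def]
  have hle : T ≤ T.adjoint := LinearPMap.IsFormalAdjoint.le_adjoint hd fun x y => hsymm x y
  refine le_antisymm (LinearPMap.le_of_le_graph ?_) hle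
  rintro ⟨y, z⟩ hyz
  obtain ⟨y', rfl, rfl⟩ := (LinearPMap.mem_graph_iff _).1 hyz
  obtain ⟨x, hx⟩ := hsurj (T.adjoint y' + y')
  -- Writing `y' - x` itself as `(T + 1) v` shows that it has the same inner product with `y'` as
  -- with `x`.
  obtain ⟨v, hv⟩ := hsurj ((y' : K) - x)
  have h1 : inner ℂ ((y' : K) - x) (y' : K) = inner ℂ (v : K) (T x + x) := by
    rw [← hv, hx, inner_add_left, inner_add_right]
    congr 1
    have := LinearPMap.adjoint_isFormalAdjoint hd y' v
    rw [← inner_conj_symm, ← this, inner_conj_symm]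
  have h2 : inner ℂ ((y' : K) - x) (x : K) = inner ℂ (v : K) (T x + x) := by
    rw [← hv, inner_add_left, inner_add_right, hsymm]
  have h3 : (y' : K) - x = 0 := by
    rw [← inner_self_eq_zero (𝕜 := ℂ), inner_sub_right, h1, h2, sub_self]
  have h4 : (y' : K) = x := sub_eq_zero.1 h3
  refine (LinearPMap.mem_graph_iff _).2 ⟨x, h4.symm, ?_⟩
  rw [← h4] at hx
  exact add_right_cancel hx

/-- Adjoints reverse inclusion: `T = T* ⊆ S* = S`. -/
lemma eq_of_isSelfAdjoint_of_le {S T : K →ₗ.[ℂ] K} (hS : IsSelfAdjoint S) (hT : IsSelfAdjoint T)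
    (h : S ≤ T) : S = T := by
  refine le_antisymm h (LinearPMap.le_of_le_graph ?_)
  rintro ⟨y, z⟩ hyz
  have h1 : ∀ x : S.domain, inner ℂ z (x : K) = inner ℂ y (S x) := fun x => by
    obtain ⟨y', rfl, rfl⟩ := (LinearPMap.mem_graph_iff _).1 hyz
    have hT' := LinearPMap.adjoint_isFormalAdjoint hT.dense_domain
    rw [LinearPMap.isSelfAdjoint_def.1 hT] at hT'
    rw [h.2 (y := ⟨x, h.1 x.2⟩) rfl]
    exact hT' y' ⟨x, h.1 x.2⟩
  have hy : y ∈ S.adjoint.domain := LinearPMap.mem_adjoint_domain_of_exists _ ⟨z, h1⟩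
  have hz := LinearPMap.adjoint_apply_eq hS.dense_domain ⟨y, hy⟩ h1
  rw [← LinearPMap.isSelfAdjoint_def.1 hS]
  exact (LinearPMap.mem_graph_iff _).2 ⟨⟨y, hy⟩, rfl, hz⟩

end SelfAdjoint

/-! ### The representation theorem for closed nonnegative forms. -/

section FormDomain

variable {K : Type*} [NormedAddCommGroup K] [InnerProductSpace ℂ K] {D : Submodule ℂ K}
  {q : D → D → ℂ}

/-- The domain of a closed form, as a Hilbert space with the form inner product. -/
def FormDomain (_hq : IsClosedNonnegForm D q) : Type _ := D

namespace FormDomain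

variable (hq : IsClosedNonnegForm D q)

instance : AddCommGroup (FormDomain hq) := inferInstanceAs (AddCommGroup D)

instance : Module ℂ (FormDomain hq) := inferInstanceAs (Module ℂ D)

/-- The identity map from the form domain, with its form inner product, to the subspace. -/
def toSubmodule : FormDomain hq ≃ₗ[ℂ] D := LinearEquiv.refl ℂ D

/-- The form inner product. -/
@[reducible] noncomputable def core : InnerProductSpace.Core ℂ (FormDomain hq) where
  -- The arguments of `q` are swapped because `q` is linear in its first slot and the inner product
  -- in its second.
  inner x y := q (toSubmodule hq y) (toSubmodule hq x) +
    inner ℂ (toSubmodule hq x : K) (toSubmodule hq y : K)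
  conj_inner_symm x y := by
    rw [map_add, ← hq.hermitian, inner_conj_symm]
  re_inner_nonneg x := by
    rw [map_add]
    exact add_nonneg (hq.nonneg _) inner_self_nonneg
  add_left x y z := by
    rw [hq.hermitian (toSubmodule hq (x + y)), map_add, hq.add_left, map_add, ← hq.hermitian,
      ← hq.hermitian, Submodule.coe_add, inner_add_left]
    ring
  smul_left x y c := by
    rw [hq.hermitian (toSubmodule hq (c • x)), map_smul, hq.smul_left, map_mul, ← hq.hermitian,
      Submodule.coe_smul, inner_smul_left]
    ring
  definite x hx := by
    have h1 : (q (toSubmodule hq x) (toSubmodule hq x)).re + ‖(toSubmodule hq x : K)‖ ^ 2 = 0 := by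
      have := congrArg Complex.re hx
      rw [Complex.add_re, inner_self_eq_norm_sq_to_K] at this
      simpa [← Complex.ofReal_pow] using this
    have h2 : ‖(toSubmodule hq x : K)‖ ^ 2 = 0 := by
      have := hq.nonneg (toSubmodule hq x)
      nlinarith [sq_nonneg ‖(toSubmodule hq x : K)‖]
    simpa using h2

noncomputable instance : NormedAddCommGroup (FormDomain hq) :=
  (core hq).toNormedAddCommGroup

noncomputable instance : InnerProductSpace ℂ (FormDomain hq) :=
  InnerProductSpace.ofCore (core hq).toCore

lemma inner_def (x y : FormDomain hq) :
    inner ℂ x y = q (toSubmodule hq y) (toSubmodule hq x) +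
      inner ℂ (toSubmodule hq x : K) (toSubmodule hq y : K) := rfl

lemma norm_sq (x : FormDomain hq) : ‖x‖ ^ 2 = formNormSq q (toSubmodule hq x) := by
  rw [← inner_self_eq_norm_sq (𝕜 := ℂ), inner_def, map_add, inner_self_eq_norm_sq]
  rfl

lemma dist_lt_iff (x y : FormDomain hq) {r : ℝ} (hr : 0 < r) :
    dist x y < r ↔ formNormSq q (toSubmodule hq x - toSubmodule hq y) < r ^ 2 := by
  rw [dist_eq_norm, ← sq_lt_sq₀ (norm_nonneg _) hr.le, norm_sq, map_sub]

instance : CompleteSpace (FormDomain hq) := by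
  refine Metric.complete_of_cauchySeq_tendsto fun u hu => ?_
  obtain ⟨v, hv⟩ := hq.complete (fun k => toSubmodule hq (u k)) fun ε hε => by
    obtain ⟨N, hN⟩ := Metric.cauchySeq_iff.1 hu (√ε) (Real.sqrt_pos.2 hε)
    refine ⟨N, fun k hk m hm => ?_⟩
    have := (dist_lt_iff hq _ _ (Real.sqrt_pos.2 hε)).1 (hN k hk m hm)
    rwa [Real.sq_sqrt hε.le] at this
  refine ⟨(toSubmodule hq).symm v, tendsto_iff_norm_sub_tendsto_zero.2 ?_⟩
  have h1 : Tendsto (fun k => ‖u k - (toSubmodule hq).symm v‖ ^ 2) atTop (𝓝 0) := by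
    simp only [norm_sq, map_sub, LinearEquiv.apply_symm_apply]
    exact hv
  have h2 := (Real.continuous_sqrt.tendsto 0).comp h1
  simpa [Function.comp_def] using h2

/-- The inclusion of the form domain in the Hilbert space. -/
noncomputable def incl : FormDomain hq →L[ℂ] K :=
  LinearMap.mkContinuous (D.subtype ∘ₗ (toSubmodule hq).toLinearMap) 1 fun x => by
    rw [one_mul]
    refine (sq_le_sq₀ (norm_nonneg _) (norm_nonneg _)).1 ?_
    rw [norm_sq, formNormSq]
    exact le_add_of_nonneg_left (hq.nonneg _)

lemma incl_apply (x : FormDomain hq) : incl hq x = (toSubmodule hq x : K) := rfl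

lemma denseRange_incl : DenseRange (incl hq) :=
  hq.dense.mono fun x hx => ⟨(toSubmodule hq).symm ⟨x, hx⟩, by simp [incl_apply]⟩

lemma incl_injective : Function.Injective (incl hq) :=
  Subtype.val_injective.comp (toSubmodule hq).injective

variable [CompleteSpace K]

/-- The orthogonal complement of the range of `ι*` is the kernel of `ι`, which is zero. This density
is the core property of the operator. -/
lemma denseRange_adjoint_incl : DenseRange (incl hq).adjoint := by
  have : (((incl hq).adjoint).range)ᗮ = ⊥ := by
    rw [ContinuousLinearMap.orthogonal_range, ContinuousLinearMap.adjoint_adjoint]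
    exact LinearMap.ker_eq_bot.2 (incl_injective hq)
  have h := (Submodule.topologicalClosure_eq_top_iff).2 this
  exact (Submodule.dense_iff_topologicalClosure_eq_top).2 h

/-- The resolvent `(T + 1)⁻¹` of the operator `T` of a closed form. -/
noncomputable def resolvent : K →L[ℂ] K := incl hq ∘L (incl hq).adjoint

lemma denseRange_resolvent : DenseRange (resolvent hq) :=
  (denseRange_incl hq).comp (denseRange_adjoint_incl hq) (incl hq).continuous

/-- `ι` is injective, and `ι*` is injective because `ι` has dense range. Hence the relation
`operatorGraph` is single-valued. -/
lemma eq_zero_of_resolvent_eq_zero {w : K} (hw : resolvent hq w = 0) : w = 0 := by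
  have h1 : (incl hq).adjoint w = 0 := incl_injective hq (hw.trans (map_zero _).symm)
  refine Dense.eq_zero_of_inner_left ℂ (denseRange_incl hq) fun v hv => ?_
  obtain ⟨x, rfl⟩ := hv
  rw [← inner_conj_symm, ← ContinuousLinearMap.adjoint_inner_right, h1, inner_zero_right,
    map_zero]

/-- The graph of the operator of a closed form. -/
noncomputable def operatorGraph : Submodule ℂ (K × K) where
  -- `w = T u` is rewritten as `(T + 1) u = u + w`, then as `u = (T + 1)⁻¹ (u + w)`.
  carrier := {p | p.1 = resolvent hq (p.1 + p.2)}
  zero_mem' := by simp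
  add_mem' {a b} ha hb := by
    simp only [Set.mem_ofPred_eq, Prod.fst_add, Prod.snd_add] at *
    rw [add_add_add_comm, map_add, ← ha, ← hb]
  smul_mem' c a ha := by
    simp only [Set.mem_ofPred_eq, Prod.smul_fst, Prod.smul_snd] at *
    rw [← smul_add, map_smul, ← ha]

lemma mem_operatorGraph {u w : K} :
    (u, w) ∈ operatorGraph hq ↔ u = resolvent hq (u + w) := Iff.rfl

/-- The operator of a closed form. -/
noncomputable def operator : K →ₗ.[ℂ] K := (operatorGraph hq).toLinearPMap

lemma graph_operator : (operator hq).graph = operatorGraph hq := by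
  refine Submodule.toLinearPMap_graph_eq _ fun p hp h0 => ?_
  have : p.1 = resolvent hq (p.1 + p.2) := hp
  rw [h0, zero_add] at this
  exact eq_zero_of_resolvent_eq_zero hq this.symm

/-- `x = ι* (u + w)` means that the form inner product of any `v` with `x` is `(v, u + w)`. When `x`
is `u`, the term `(v, u)` cancels and the identity `q(u, v) = (w, v)` is left. -/
lemma mem_graph_operator_iff (u w : K) :
    (u, w) ∈ (operator hq).graph ↔ ∃ hu : u ∈ D, ∀ v : D, q ⟨u, hu⟩ v = inner ℂ (v : K) w := by
  rw [graph_operator, mem_operatorGraph]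
  constructor
  · intro h
    set x : FormDomain hq := (incl hq).adjoint (u + w)
    have hx : (toSubmodule hq x : K) = u := h.symm
    refine ⟨hx ▸ (toSubmodule hq x).2, fun v => ?_⟩
    have key := ContinuousLinearMap.adjoint_inner_right (incl hq) ((toSubmodule hq).symm v) (u + w)
    rw [inner_def, inner_add_right, incl_apply, LinearEquiv.apply_symm_apply] at key
    change q (toSubmodule hq x) v + inner ℂ (v : K) (toSubmodule hq x : K) = _ at key
    rw [hx, add_comm] at key
    have hux : (⟨u, hx ▸ (toSubmodule hq x).2⟩ : D) = toSubmodule hq x := Subtype.ext hx.symm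
    rw [hux]
    exact add_left_cancel key
  · rintro ⟨hu, h⟩
    have : (incl hq).adjoint (u + w) = (toSubmodule hq).symm ⟨u, hu⟩ := by
      refine ext_inner_left ℂ fun v => ?_
      rw [ContinuousLinearMap.adjoint_inner_right, inner_def, inner_add_right,
        LinearEquiv.apply_symm_apply, h, add_comm]
      rfl
    change u = incl hq ((incl hq).adjoint (u + w))
    rw [this, incl_apply, LinearEquiv.apply_symm_apply]

lemma resolvent_mem_domain (w : K) : resolvent hq w ∈ (operator hq).domain := by
  refine LinearPMap.mem_domain_of_mem_graph (y := w - resolvent hq w) ?_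
  rw [graph_operator, mem_operatorGraph, add_sub_cancel]

lemma isFormOperator_operator : IsFormOperator q (operator hq) where
  mem_graph_iff := mem_graph_operator_iff hq
  core u ε hε := by
    obtain ⟨w, hw⟩ := Metric.denseRange_iff.1 (denseRange_adjoint_incl hq)
      ((toSubmodule hq).symm u) (√ε) (Real.sqrt_pos.2 hε)
    rw [dist_lt_iff hq _ _ (Real.sqrt_pos.2 hε), Real.sq_sqrt hε.le,
      LinearEquiv.apply_symm_apply] at hw
    exact ⟨toSubmodule hq ((incl hq).adjoint w), resolvent_mem_domain hq w, hw⟩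

lemma isSelfAdjoint_operator : IsSelfAdjoint (operator hq) := by
  have hgr : ∀ x : (operator hq).domain, ∃ hu : (x : K) ∈ D, ∀ v : D,
      q ⟨x, hu⟩ v = inner ℂ (v : K) (operator hq x) := fun x =>
    (mem_graph_operator_iff hq _ _).1 ((operator hq).mem_graph x)
  refine isSelfAdjoint_of_surjective_add_id ?_ (fun x y => ?_) fun w => ?_
  · refine (denseRange_resolvent hq).mono ?_
    rintro _ ⟨w, rfl⟩
    exact resolvent_mem_domain hq w
  · obtain ⟨hx, hx'⟩ := hgr x
    obtain ⟨hy, hy'⟩ := hgr y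
    have h1 := hx' ⟨y, hy⟩
    have h2 := hy' ⟨x, hx⟩
    rw [← inner_conj_symm, ← h2, hq.hermitian, h1]
  · have hg : (resolvent hq w, w - resolvent hq w) ∈ (operator hq).graph := by
      rw [graph_operator, mem_operatorGraph, add_sub_cancel]
    obtain ⟨x, hx1, hx2⟩ := (LinearPMap.mem_graph_iff _).1 hg
    refine ⟨x, ?_⟩
    rw [hx2, hx1]
    exact sub_add_cancel _ _

end FormDomain

/-- After adding `(v, u)`, both sides become continuous in `v` for the form norm: a form inner
product and a composite of `ι`. -/
lemma IsClosedNonnegForm.eq_inner_of_dense (hq : IsClosedNonnegForm D q) {P : D → Prop}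
    (hP : ∀ v : D, ∀ ε > 0, ∃ v' : D, P v' ∧ formNormSq q (v - v') < ε) {u : D} {w : K}
    (h : ∀ v : D, P v → q u v = inner ℂ (v : K) w) (v : D) : q u v = inner ℂ (v : K) w := by
  have hd : Dense {v : FormDomain hq | P (FormDomain.toSubmodule hq v)} := by
    refine Metric.dense_iff.2 fun v r hr => ?_
    obtain ⟨v', hv', hlt⟩ := hP (FormDomain.toSubmodule hq v) (r ^ 2) (by positivity)
    refine ⟨(FormDomain.toSubmodule hq).symm v', ?_, ?_⟩
    · rw [Metric.mem_ball', FormDomain.dist_lt_iff hq _ _ hr, LinearEquiv.apply_symm_apply]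
      exact hlt
    · rwa [Set.mem_ofPred_eq, LinearEquiv.apply_symm_apply]
  have hc1 : Continuous fun v : FormDomain hq => inner ℂ v ((FormDomain.toSubmodule hq).symm u) :=
    continuous_id.inner continuous_const
  have hc2 : Continuous fun v : FormDomain hq => inner ℂ (FormDomain.incl hq v) (w + u) :=
    (FormDomain.incl hq).continuous.inner continuous_const
  have heq := hc1.ext_on hd hc2 fun v hv => by
    simp only [FormDomain.inner_def, FormDomain.incl_apply, LinearEquiv.apply_symm_apply]
    rw [h _ hv, inner_add_right]
  have := congrFun heq ((FormDomain.toSubmodule hq).symm v)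
  simp only [FormDomain.inner_def, FormDomain.incl_apply, LinearEquiv.apply_symm_apply,
    inner_add_right] at this
  exact add_right_cancel this

end FormDomain

/-! ### The magnetic form -/

/-- Form smallness of `|A|²` and `|B|` relative to the Laplacian. -/
structure FormSmall {n : ℕ} (A : Rn n → Rn n) (B : Rn n → ℝ) : Prop where
  aemeasurable_A : AEMeasurable A volume
  aemeasurable_B : AEMeasurable B volume
  hardy_A : ∀ u : H1 n, ∫⁻ x, ‖A x‖ₑ ^ 2 * ‖(u : L2 n) x‖ₑ ^ 2 ≤ ENNReal.ofReal (gradSq u / 8)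
  hardy_B : ∀ u : H1 n, ∫⁻ x, ‖B x‖ₑ * ‖(u : L2 n) x‖ₑ ^ 2 ≤ ENNReal.ofReal (gradSq u / 8)

lemma exists_formSmall_of_weakLpNorm_le {n : ℕ} (hn : 3 ≤ n) :
    ∃ C₀ : ℝ, 0 < C₀ ∧ ∀ (A : Rn n → Rn n) (B : Rn n → ℝ), AEMeasurable A volume →
      AEMeasurable B volume → weakLpNorm (n : ℝ) A ≤ ENNReal.ofReal C₀ →
      weakLpNorm ((n : ℝ) / 2) B ≤ ENNReal.ofReal C₀ → FormSmall A B := by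
  obtain ⟨C, hC, hhardy⟩ := exists_lintegral_mul_enorm_sq_le_gradSq hn
  -- The factor `24 = 3 * 8` turns the constant `3` of the weak-norm bounds into the smallness
  -- `1/8`; the cap at `1` gives `c² ≤ c`, which covers `|A|²`.
  refine ⟨min 1 (1 / (24 * C)), by positivity, fun A B hA hB hA' hB' => ?_⟩
  set c := min 1 (1 / (24 * C))
  have hc0 : 0 < c := by positivity
  have hc1 : c ≤ 1 := min_le_left _ _
  have hcC : C * (3 * c) ≤ 1 / 8 := by
    have : c ≤ 1 / (24 * C) := min_le_right _ _
    rw [le_div_iff₀ (by positivity)] at this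
    linarith
  have hcC2 : C * (3 * c ^ 2) ≤ 1 / 8 := by
    have : c ^ 2 ≤ c := by nlinarith
    refine le_trans ?_ hcC
    gcongr
  refine ⟨hA, hB, fun u => ?_, fun u => ?_⟩
  · refine (hhardy (fun x => ‖A x‖ₑ ^ 2) (hA.enorm.pow_const 2) (by simp) _ (by positivity)
      (setLIntegral_enorm_sq_le_of_weakLpNorm hn hA hc0 hA') u).trans ?_
    refine ENNReal.ofReal_le_ofReal ?_
    have := mul_le_mul_of_nonneg_right hcC2 (gradSq_nonneg u)
    linarith
  · refine (hhardy (fun x => ‖B x‖ₑ) hB.enorm (by simp) _ (by positivity)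
      (setLIntegral_enorm_le_of_weakLpNorm hn hB hc0 hB') u).trans ?_
    refine ENNReal.ofReal_le_ofReal ?_
    have := mul_le_mul_of_nonneg_right hcC (gradSq_nonneg u)
    linarith

namespace FormSmall

variable {n : ℕ} {A : Rn n → Rn n} {B : Rn n → ℝ}

lemma aemeasurable_coord (h : FormSmall A B) (j : Fin n) : AEMeasurable (fun x => A x j) volume :=
  (EuclideanSpace.proj (𝕜 := ℝ) j).continuous.measurable.comp_aemeasurable h.aemeasurable_A

lemma enorm_vectorPotential_mul_sq (a : ℝ) (z : ℂ) :
    ‖Complex.I * (a : ℂ) * z‖ₑ ^ 2 = ‖a‖ₑ ^ 2 * ‖z‖ₑ ^ 2 := by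
  simp only [← ofReal_norm, ← ENNReal.ofReal_pow (norm_nonneg _)]
  rw [← ENNReal.ofReal_mul (by positivity)]
  simp [mul_pow]

lemma sum_lintegral_vectorPotential_le (h : FormSmall A B) (u : H1 n) :
    ∑ j, ∫⁻ x, ‖Complex.I * (A x j : ℂ) * (u : L2 n) x‖ₑ ^ 2 ≤ ENNReal.ofReal (gradSq u / 8) := by
  refine le_trans (le_of_eq ?_) (h.hardy_A u)
  simp only [enorm_vectorPotential_mul_sq]
  have hm : ∀ j, AEMeasurable (fun x => ‖A x j‖ₑ ^ 2 * ‖(u : L2 n) x‖ₑ ^ 2) volume := fun j =>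
    ((h.aemeasurable_coord j).enorm.pow_const 2).mul ((Lp.aestronglyMeasurable _).enorm.pow_const 2)
  rw [← lintegral_finsetSum' _ fun j _ => hm j]
  refine lintegral_congr fun x => ?_
  rw [← Finset.sum_mul]
  congr 1
  simp only [← ofReal_norm, ← ENNReal.ofReal_pow (norm_nonneg _)]
  rw [← ENNReal.ofReal_sum_of_nonneg fun _ _ => by positivity, EuclideanSpace.norm_sq_eq]

lemma memLp_vectorPotential (h : FormSmall A B) (u : H1 n) (j : Fin n) :
    MemLp (fun x => Complex.I * (A x j : ℂ) * (u : L2 n) x) 2 volume := by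
  refine ⟨((Complex.measurable_ofReal.comp_aemeasurable
    (h.aemeasurable_coord j)).const_mul _).aestronglyMeasurable.mul (Lp.aestronglyMeasurable _), ?_⟩
  have h1 : eLpNorm (fun x => Complex.I * (A x j : ℂ) * (u : L2 n) x) 2 volume ^ 2 < ⊤ := by
    rw [eLpNorm_two_sq]
    refine lt_of_le_of_lt ?_ ((h.sum_lintegral_vectorPotential_le u).trans_lt ENNReal.ofReal_lt_top)
    exact Finset.single_le_sum
      (f := fun j => ∫⁻ x, ‖Complex.I * (A x j : ℂ) * (u : L2 n) x‖ₑ ^ 2)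
      (fun _ _ => bot_le) (Finset.mem_univ j)
  exact (ENNReal.pow_lt_top_iff.1 h1).resolve_right two_ne_zero

lemma memLp_covDerivH1 (h : FormSmall A B) (u : H1 n) (j : Fin n) :
    MemLp (covDerivH1 A u j) 2 volume :=
  (Lp.memLp (weakPartial u j)).add (h.memLp_vectorPotential u j)

lemma integrable_potential (h : FormSmall A B) (u v : H1 n) :
    Integrable (fun x => (B x : ℂ) * (u : L2 n) x * conj ((v : L2 n) x)) volume := by
  have hsq : ∀ u : H1 n, Integrable (fun x => ‖B x‖ * ‖(u : L2 n) x‖ ^ 2) volume := fun u => by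
    refine ⟨h.aemeasurable_B.norm.aestronglyMeasurable.mul
      ((Lp.aestronglyMeasurable _).norm.pow 2), ?_⟩
    refine lt_of_le_of_lt (le_of_eq ?_) ((h.hardy_B u).trans_lt ENNReal.ofReal_lt_top)
    refine lintegral_congr fun x => ?_
    rw [enorm_mul, enorm_norm, enorm_pow, enorm_norm]
  refine (((hsq u).add (hsq v)).const_mul (1 / 2)).mono'
    (((Complex.measurable_ofReal.comp_aemeasurable h.aemeasurable_B).aestronglyMeasurable.mul
      (Lp.aestronglyMeasurable _)).mul (Lp.aestronglyMeasurable _).star)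
    (Eventually.of_forall fun x => ?_)
  have e : ‖(B x : ℂ) * (u : L2 n) x * conj ((v : L2 n) x)‖ =
      ‖B x‖ * (‖(u : L2 n) x‖ * ‖(v : L2 n) x‖) := by
    simp [mul_assoc]
  rw [e]
  have := mul_le_mul_of_nonneg_left (two_mul_le_add_sq ‖(u : L2 n) x‖ ‖(v : L2 n) x‖)
    (norm_nonneg (B x))
  simp only [Pi.add_apply]
  linarith

lemma formWellDefined (h : FormSmall A B) :
    FormWellDefined A B := ⟨h.memLp_covDerivH1, h.integrable_potential⟩

/-- The covariant derivative as an element of `L²`. -/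
noncomputable def covLp (h : FormSmall A B) (u : H1 n) (j : Fin n) :
    L2 n := (h.memLp_covDerivH1 u j).toLp _

/-- The product `i Aⱼ u` as an element of `L²`. -/
noncomputable def magLp (h : FormSmall A B) (u : H1 n) (j : Fin n) :
    L2 n := (h.memLp_vectorPotential u j).toLp _

lemma covLp_eq (h : FormSmall A B) (u : H1 n) (j : Fin n) :
    h.covLp u j = weakPartial u j + h.magLp u j := by
  refine Lp.ext ?_
  filter_upwards [(h.memLp_covDerivH1 u j).coeFn_toLp, (h.memLp_vectorPotential u j).coeFn_toLp,
    Lp.coeFn_add (weakPartial u j) (h.magLp u j)] with x h1 h2 h3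
  rw [h3, Pi.add_apply, covLp, magLp, h1, h2]
  rfl

lemma magLp_add (h : FormSmall A B) (u v : H1 n) (j : Fin n) :
    h.magLp (u + v) j = h.magLp u j + h.magLp v j := by
  refine Lp.ext ?_
  filter_upwards [(h.memLp_vectorPotential (u + v) j).coeFn_toLp,
    (h.memLp_vectorPotential u j).coeFn_toLp, (h.memLp_vectorPotential v j).coeFn_toLp,
    Lp.coeFn_add (h.magLp u j) (h.magLp v j), Lp.coeFn_add (u : L2 n) (v : L2 n)]
    with x h1 h2 h3 h4 h5
  rw [h4, Pi.add_apply, magLp, magLp, magLp, h1, h2, h3, Submodule.coe_add, h5, Pi.add_apply,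
    mul_add]

lemma magLp_smul (h : FormSmall A B) (c : ℂ) (u : H1 n) (j : Fin n) :
    h.magLp (c • u) j = c • h.magLp u j := by
  refine Lp.ext ?_
  filter_upwards [(h.memLp_vectorPotential (c • u) j).coeFn_toLp,
    (h.memLp_vectorPotential u j).coeFn_toLp, Lp.coeFn_smul c (h.magLp u j),
    Lp.coeFn_smul c (u : L2 n)] with x h1 h2 h3 h4
  rw [h3, Pi.smul_apply, magLp, magLp, h1, h2, Submodule.coe_smul, h4, Pi.smul_apply,
    smul_eq_mul, smul_eq_mul]
  ring

lemma sum_norm_magLp_sq_le (h : FormSmall A B) (u : H1 n) :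
    ∑ j, ‖h.magLp u j‖ ^ 2 ≤ gradSq u / 8 := by
  have hG := gradSq_nonneg u
  refine (ENNReal.ofReal_le_ofReal_iff (by positivity)).1 ?_
  rw [ENNReal.ofReal_sum_of_nonneg fun _ _ => by positivity]
  refine le_trans (le_of_eq ?_) (h.sum_lintegral_vectorPotential_le u)
  refine Finset.sum_congr rfl fun j _ => ?_
  rw [ofReal_norm_sq_eq_lintegral]
  refine lintegral_congr_ae ?_
  filter_upwards [(h.memLp_vectorPotential u j).coeFn_toLp] with x hx
  rw [magLp, hx]

/-- The potential part of the form. -/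
noncomputable def potForm (B : Rn n → ℝ) (u v : H1 n) : ℂ :=
  ∫ x, (B x : ℂ) * (u : L2 n) x * conj ((v : L2 n) x)

lemma norm_potForm_self_le (h : FormSmall A B) (u : H1 n) : ‖potForm B u u‖ ≤ gradSq u / 8 := by
  have hG := gradSq_nonneg u
  refine (ENNReal.ofReal_le_ofReal_iff (by positivity)).1 ?_
  rw [ofReal_norm]
  refine (enorm_integral_le_lintegral_enorm _).trans (le_trans (le_of_eq ?_) (h.hardy_B u))
  refine lintegral_congr fun x => ?_
  simp only [← ofReal_norm, ← ENNReal.ofReal_pow (norm_nonneg _)]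
  rw [← ENNReal.ofReal_mul (norm_nonneg _)]
  congr 1
  simp [mul_assoc, sq]

lemma magForm_eq (h : FormSmall A B) (u v : H1 n) :
    magForm A B u v = ∑ j, inner ℂ (h.covLp v j) (h.covLp u j) + potForm B u v := by
  rw [magForm, potForm]
  congr 1
  refine Finset.sum_congr rfl fun j _ => ?_
  rw [L2.inner_def]
  refine integral_congr_ae ?_
  filter_upwards [(h.memLp_covDerivH1 u j).coeFn_toLp, (h.memLp_covDerivH1 v j).coeFn_toLp]
    with x h1 h2
  rw [covLp, covLp, h1, h2, RCLike.inner_apply]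

lemma potForm_add_left (h : FormSmall A B) (u v w : H1 n) :
    potForm B (u + v) w = potForm B u w + potForm B v w := by
  simp only [potForm]
  rw [← integral_add (h.integrable_potential u w) (h.integrable_potential v w)]
  refine integral_congr_ae ?_
  filter_upwards [Lp.coeFn_add (u : L2 n) (v : L2 n)] with x hx
  rw [Submodule.coe_add, hx, Pi.add_apply]
  ring

lemma potForm_smul_left (c : ℂ) (u v : H1 n) : potForm B (c • u) v = c * potForm B u v := by
  simp only [potForm]
  rw [← integral_const_mul]
  refine integral_congr_ae ?_
  filter_upwards [Lp.coeFn_smul c (u : L2 n)] with x hx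
  rw [Submodule.coe_smul, hx, Pi.smul_apply, smul_eq_mul]
  ring

lemma potForm_conj (u v : H1 n) : potForm B v u = conj (potForm B u v) := by
  simp only [potForm]
  rw [← integral_conj]
  congr 1
  ext x
  simp only [map_mul, Complex.conj_ofReal, Complex.conj_conj]
  ring

lemma re_magForm_self (h : FormSmall A B) (u : H1 n) :
    (magForm A B u u).re = ∑ j, ‖h.covLp u j‖ ^ 2 + (potForm B u u).re := by
  rw [h.magForm_eq, Complex.add_re, Complex.re_sum]
  congr 1
  refine Finset.sum_congr rfl fun j _ => ?_
  exact inner_self_eq_norm_sq (𝕜 := ℂ) _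

/-- From `|∇u|² ≤ 2 |(∇ + iA)u|² + 2 |Au|²` the coefficient is `1/2 - 1/8 - 1/8 = 1/4`. -/
lemma gradSq_le_re_magForm (h : FormSmall A B) (u : H1 n) :
    gradSq u / 4 ≤ (magForm A B u u).re := by
  rw [h.re_magForm_self]
  have h1 := h.sum_norm_magLp_sq_le u
  have h2 := (abs_le.1 ((Complex.abs_re_le_norm _).trans (h.norm_potForm_self_le u))).1
  have h3 : gradSq u / 2 - ∑ j, ‖h.magLp u j‖ ^ 2 ≤ ∑ j, ‖h.covLp u j‖ ^ 2 := by
    rw [gradSq, Finset.sum_div, ← Finset.sum_sub_distrib]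
    refine Finset.sum_le_sum fun j _ => ?_
    have htri : ‖weakPartial u j‖ ≤ ‖h.covLp u j‖ + ‖h.magLp u j‖ := by
      have := norm_sub_le (h.covLp u j) (h.magLp u j)
      rwa [h.covLp_eq, add_sub_cancel_right, ← h.covLp_eq] at this
    have := pow_le_pow_left₀ (norm_nonneg _) htri 2
    nlinarith [sq_nonneg (‖h.covLp u j‖ - ‖h.magLp u j‖)]
  linarith

/-- The same splitting gives `2 + 2/8 + 1/8`, which is below `3`. -/
lemma re_magForm_le (h : FormSmall A B) (u : H1 n) : (magForm A B u u).re ≤ 3 * gradSq u := by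
  rw [h.re_magForm_self]
  have h0 := gradSq_nonneg u
  have h1 := h.sum_norm_magLp_sq_le u
  have h2 := (abs_le.1 ((Complex.abs_re_le_norm _).trans (h.norm_potForm_self_le u))).2
  have h3 : ∑ j, ‖h.covLp u j‖ ^ 2 ≤ 2 * gradSq u + 2 * ∑ j, ‖h.magLp u j‖ ^ 2 := by
    rw [gradSq, Finset.mul_sum, Finset.mul_sum, ← Finset.sum_add_distrib]
    refine Finset.sum_le_sum fun j _ => ?_
    have htri : ‖h.covLp u j‖ ≤ ‖weakPartial u j‖ + ‖h.magLp u j‖ := by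
      rw [h.covLp_eq]
      exact norm_add_le _ _
    have := pow_le_pow_left₀ (norm_nonneg _) htri 2
    nlinarith [sq_nonneg (‖weakPartial u j‖ - ‖h.magLp u j‖)]
  linarith

lemma tendsto_formNormSq (h : FormSmall A B) {u : ℕ → H1 n} {v : H1 n}
    (hu : Tendsto (fun k => (u k : L2 n)) atTop (𝓝 v))
    (hg : ∀ j, Tendsto (fun k => weakPartial (u k) j) atTop (𝓝 (weakPartial v j))) :
    Tendsto (fun k => formNormSq (magForm A B) (u k - v)) atTop (𝓝 0) := by
  have hbound : ∀ k, formNormSq (magForm A B) (u k - v) ≤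
      3 * ∑ j, ‖weakPartial (u k) j - weakPartial v j‖ ^ 2 + ‖(u k : L2 n) - v‖ ^ 2 := fun k => by
    have := h.re_magForm_le (u k - v)
    simp only [gradSq, weakPartial_sub] at this
    rw [formNormSq, Submodule.coe_sub]
    linarith
  have hlim : Tendsto (fun k => 3 * ∑ j, ‖weakPartial (u k) j - weakPartial v j‖ ^ 2 +
      ‖(u k : L2 n) - v‖ ^ 2) atTop (𝓝 0) := by
    have h1 : ∀ j, Tendsto (fun k => ‖weakPartial (u k) j - weakPartial v j‖ ^ 2) atTop (𝓝 0) :=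
      fun j => by simpa using (tendsto_iff_norm_sub_tendsto_zero.1 (hg j)).pow 2
    have h2 : Tendsto (fun k => ‖(u k : L2 n) - v‖ ^ 2) atTop (𝓝 0) := by
      simpa using (tendsto_iff_norm_sub_tendsto_zero.1 hu).pow 2
    simpa using ((tendsto_finsetSum Finset.univ fun j _ => h1 j).const_mul 3).add h2
  refine squeeze_zero (fun k => ?_) hbound hlim
  have h1 := h.gradSq_le_re_magForm (u k - v)
  have h2 := gradSq_nonneg (u k - v)
  rw [formNormSq]
  nlinarith [sq_nonneg ‖((u k - v : H1 n) : L2 n)‖]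

lemma isClosedNonnegForm (h : FormSmall A B) : IsClosedNonnegForm (H1 n) (magForm A B) where
  dense := dense_H1
  add_left u v w := by
    simp only [h.magForm_eq, h.potForm_add_left, h.covLp_eq, weakPartial_add, h.magLp_add]
    rw [add_add_add_comm, ← Finset.sum_add_distrib]
    congr 1
    refine Finset.sum_congr rfl fun j _ => ?_
    rw [← inner_add_right, add_add_add_comm]
  smul_left c u v := by
    simp only [h.magForm_eq, potForm_smul_left, h.covLp_eq, weakPartial_smul, h.magLp_smul]
    rw [mul_add, Finset.mul_sum]
    congr 1
    refine Finset.sum_congr rfl fun j _ => ?_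
    rw [← smul_add, inner_smul_right]
  hermitian u v := by
    simp only [h.magForm_eq]
    rw [map_add, map_sum, ← potForm_conj]
    simp only [inner_conj_symm]
  nonneg u := by
    have h1 := h.gradSq_le_re_magForm u
    have h2 := gradSq_nonneg u
    linarith
  complete u hu := by
    -- The form norm controls the `H¹` norm, so a form-Cauchy sequence is Cauchy in `H¹`.
    have hle : ∀ w : H1 n, ‖(w : L2 n)‖ ^ 2 ≤ formNormSq (magForm A B) w ∧
        ∀ j, ‖weakPartial w j‖ ^ 2 ≤ 4 * formNormSq (magForm A B) w := fun w => by
      have h1 := h.gradSq_le_re_magForm w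
      have h2 := gradSq_nonneg w
      have h3 := sq_nonneg ‖(w : L2 n)‖
      refine ⟨by rw [formNormSq]; linarith, fun j => ?_⟩
      have h4 : ‖weakPartial w j‖ ^ 2 ≤ gradSq w :=
        Finset.single_le_sum (f := fun j => ‖weakPartial w j‖ ^ 2)
          (fun _ _ => by positivity) (Finset.mem_univ j)
      rw [formNormSq]
      linarith
    obtain ⟨v, hv, hg⟩ := exists_tendsto_H1 u
      (Metric.cauchySeq_iff.2 fun ε hε => by
        obtain ⟨N, hN⟩ := hu (ε ^ 2) (by positivity)
        refine ⟨N, fun k hk m hm => ?_⟩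
        rw [dist_eq_norm, ← Submodule.coe_sub]
        exact (sq_lt_sq₀ (norm_nonneg _) hε.le).1 ((hle _).1.trans_lt (hN k hk m hm)))
      (fun j => Metric.cauchySeq_iff.2 fun ε hε => by
        obtain ⟨N, hN⟩ := hu (ε ^ 2 / 4) (by positivity)
        refine ⟨N, fun k hk m hm => ?_⟩
        rw [dist_eq_norm, ← weakPartial_sub]
        refine (sq_lt_sq₀ (norm_nonneg _) hε.le).1 (((hle _).2 j).trans_lt ?_)
        have := hN k hk m hm
        linarith)
    exact ⟨v, h.tendsto_formNormSq hv hg⟩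

lemma exists_toH1_formNormSq_lt (h : FormSmall A B) (v : H1 n) {ε : ℝ} (hε : 0 < ε) :
    ∃ v' : H1 n, (∃ (φ : Rn n → ℂ) (hφ : IsTest φ), v' = hφ.toH1) ∧
      formNormSq (magForm A B) (v - v') < ε := by
  obtain ⟨φ, hφ, hlim, hglim⟩ := exists_seq_toH1_tendsto v
  obtain ⟨k, hk⟩ := ((h.tendsto_formNormSq hlim hglim).eventually_lt_const hε).exists
  refine ⟨_, ⟨φ k, hφ k, rfl⟩, ?_⟩
  have hq := h.isClosedNonnegForm
  -- Evenness of the form norm swaps the order of the difference delivered by `tendsto_formNormSq`.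
  have hneg : ∀ w : H1 n, formNormSq (magForm A B) (-w) = formNormSq (magForm A B) w := fun w => by
    have := FormDomain.norm_sq hq ((FormDomain.toSubmodule hq).symm (-w))
    rw [map_neg, norm_neg, FormDomain.norm_sq, map_neg, LinearEquiv.apply_symm_apply] at this
    exact this.symm
  rwa [← hneg, neg_sub]

end FormSmall

/-! ### The magnetic Laplacian as a distribution -/

section Distribution

variable {n : ℕ}

lemma IsTest.conj {φ : Rn n → ℂ} (hφ : IsTest φ) : IsTest fun x => conj (φ x) :=
  ⟨Complex.conjCLE.contDiff.comp hφ.smooth, hφ.compact.comp_left (g := fun z : ℂ => conj z)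
      (by simp)⟩

lemma IsTest.pderiv_conj {φ : Rn n → ℂ} (hφ : IsTest φ) (j : Fin n) (x : Rn n) :
    pderiv j (fun x => conj (φ x)) x = conj (pderiv j φ x) := by
  have h1 : HasFDerivAt φ (fderiv ℝ φ x) x := (hφ.smooth.differentiable (by simp) x).hasFDerivAt
  have h2 : HasFDerivAt (fun x => conj (φ x)) _ x :=
    Complex.conjCLE.toContinuousLinearMap.hasFDerivAt.comp x h1
  rw [pderiv, h2.fderiv]
  simp [pderiv]

lemma IsTest.integral_mul_eq_inner_toH1 {φ : Rn n → ℂ} (hφ : IsTest φ) (w : L2 n) :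
    ∫ x, w x * φ x = inner ℂ (hφ.conj.toH1 : L2 n) w := by
  rw [L2.inner_def]
  refine integral_congr_ae ?_
  filter_upwards [hφ.conj.coeFn_toH1] with x hx
  rw [hx, RCLike.inner_apply, Complex.conj_conj]

/-- The distributional pairing is bilinear and the form sesquilinear, hence the conjugate. Since `A`
is real, the conjugate of `(∂ⱼ + i Aⱼ) (conj φ)` is `(∂ⱼ - i Aⱼ) φ`. -/
lemma IsTest.distribH_eq_magForm {φ : Rn n → ℂ} (hφ : IsTest φ) (A : Rn n → Rn n)
    (B : Rn n → ℝ) (u : H1 n) :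
    distribH A B (u : L2 n) (fun j => weakPartial u j) φ = magForm A B u hφ.conj.toH1 := by
  rw [distribH, magForm]
  congr 1
  · refine Finset.sum_congr rfl fun j _ => integral_congr_ae ?_
    filter_upwards [hφ.conj.coeFn_toH1, hφ.conj.coeFn_weakPartial_toH1 j] with x h1 h2
    simp only [covDerivH1, covDeriv, h1, h2, hφ.pderiv_conj, map_add, map_mul, Complex.conj_conj,
      Complex.conj_I, Complex.conj_ofReal]
    ring
  · refine integral_congr_ae ?_
    filter_upwards [hφ.conj.coeFn_toH1] with x h1
    rw [h1, Complex.conj_conj]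

/-- The distributional equation is the form identity restricted to test functions `v`, and these are
dense in the form norm. -/
lemma FormSmall.weaklyEq_iff {A : Rn n → Rn n} {B : Rn n → ℝ} (h : FormSmall A B) (u : H1 n)
    (w : L2 n) : WeaklyEq A B u w ↔ ∀ v : H1 n, magForm A B u v = inner ℂ (v : L2 n) w := by
  constructor
  · intro hw
    refine h.isClosedNonnegForm.eq_inner_of_dense
        (fun v ε hε => h.exists_toH1_formNormSq_lt v hε) ?_
    rintro _ ⟨φ, hφ, rfl⟩
    have := hw _ hφ.conj
    rw [hφ.conj.integral_mul_eq_inner_toH1, hφ.conj.distribH_eq_magForm] at this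
    have e : hφ.conj.conj.toH1 = hφ.toH1 := by
      congr 1
      simp
    rw [← e, this]
  · intro hq η hη
    rw [hη.integral_mul_eq_inner_toH1, hη.distribH_eq_magForm, hq]

lemma WeaklyEqTest.weaklyEq {A : Rn n → Rn n} {B : Rn n → ℝ} {φ : Rn n → ℂ} (hφ : IsTest φ)
    {w : L2 n} (h : WeaklyEqTest A B φ w) : WeaklyEq A B hφ.toH1 w := by
  intro η hη
  rw [h η hη, distribH, distribH]
  congr 1
  · refine Finset.sum_congr rfl fun j _ => integral_congr_ae ?_
    filter_upwards [hφ.coeFn_toH1, hφ.coeFn_weakPartial_toH1 j] with x h1 h2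
    simp only [covDeriv, h1, h2]
  · refine integral_congr_ae ?_
    filter_upwards [hφ.coeFn_toH1] with x h1
    rw [h1]

end Distribution

end MagneticLaplacian

theorem proposition2p1 (n : ℕ) (hn : 3 ≤ n) :
    ∃ C₀ : ℝ, 0 < C₀ ∧
      ∀ (A : MagneticLaplacian.Rn n → MagneticLaplacian.Rn n) (B : MagneticLaplacian.Rn n → ℝ),
        AEMeasurable A volume → AEMeasurable B volume →
        MagneticLaplacian.weakLpNorm (n : ℝ) A ≤ ENNReal.ofReal C₀ →
        MagneticLaplacian.weakLpNorm ((n : ℝ) / 2) B ≤ ENNReal.ofReal C₀ →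
        -- the form is well defined on `H¹`, nonnegative and closed
        MagneticLaplacian.FormWellDefined A B ∧
        MagneticLaplacian.IsClosedNonnegForm (MagneticLaplacian.H1 n)
          (MagneticLaplacian.magForm A B) ∧
        ∃ T : MagneticLaplacian.L2 n →ₗ.[ℂ] MagneticLaplacian.L2 n,
          -- `T` is self-adjoint and is the operator of the form
          IsSelfAdjoint T ∧
          MagneticLaplacian.IsFormOperator (MagneticLaplacian.magForm A B) T ∧
          -- `T` acts as `H` in the sense of distributions, on its maximal domain in `H¹`
          (∀ u w : MagneticLaplacian.L2 n, (u, w) ∈ T.graph ↔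
            ∃ hu : u ∈ MagneticLaplacian.H1 n, MagneticLaplacian.WeaklyEq A B ⟨u, hu⟩ w) ∧
          -- `T` extends `H` on test functions
          (∀ (φ : MagneticLaplacian.Rn n → ℂ) (hφ : MagneticLaplacian.IsTest φ)
            (w : MagneticLaplacian.L2 n),
            MagneticLaplacian.WeaklyEqTest A B φ w → (hφ.memLp.toLp φ, w) ∈ T.graph) ∧
          -- uniqueness: among self-adjoint operators with domain in `H¹` that act as `H`
          (∀ S : MagneticLaplacian.L2 n →ₗ.[ℂ] MagneticLaplacian.L2 n, IsSelfAdjoint S →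
            (∀ u w : MagneticLaplacian.L2 n, (u, w) ∈ S.graph →
              ∃ hu : u ∈ MagneticLaplacian.H1 n, MagneticLaplacian.WeaklyEq A B ⟨u, hu⟩ w) →
            S = T) := by
  obtain ⟨C₀, hC₀, hsmall⟩ := MagneticLaplacian.exists_formSmall_of_weakLpNorm_le hn
  refine ⟨C₀, hC₀, fun A B hA hB hA' hB' => ?_⟩
  have h := hsmall A B hA hB hA' hB'
  have hq := h.isClosedNonnegForm
  have hgraph : ∀ u w : MagneticLaplacian.L2 n,
      (u, w) ∈ (MagneticLaplacian.FormDomain.operator hq).graph ↔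
        ∃ hu : u ∈ MagneticLaplacian.H1 n, MagneticLaplacian.WeaklyEq A B ⟨u, hu⟩ w := fun u w => by
    rw [MagneticLaplacian.FormDomain.mem_graph_operator_iff]
    exact exists_congr fun hu => (h.weaklyEq_iff ⟨u, hu⟩ w).symm
  have hsa := MagneticLaplacian.FormDomain.isSelfAdjoint_operator hq
  refine ⟨h.formWellDefined, hq, MagneticLaplacian.FormDomain.operator hq, hsa,
    MagneticLaplacian.FormDomain.isFormOperator_operator hq, hgraph, fun φ hφ w hw => ?_,
    fun S hS hSH => ?_⟩
  · exact (hgraph _ _).2 ⟨hφ.toH1.2, hw.weaklyEq hφ⟩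
  -- The assumption on `S` places its graph inside the graph of `T`, already known to contain every
  -- pair in `H¹ × L²` solving `H u = w`.
  · exact MagneticLaplacian.eq_of_isSelfAdjoint_of_le hS hsa
      (LinearPMap.le_of_le_graph fun p hp => (hgraph p.1 p.2).2 (hSH p.1 p.2 hp))
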